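/- Let $\alpha>-1$. Consider the probability measure $\mu_\alpha(dx)=\frac{x^{\alpha}e^{-x}}{\Gamma(\alpha+1)}\,dx$ on $(0,\infty)$, the complex Hilbert space $\mathcal H=L^2(\mu_\alpha)$ and the normalized Laguerre polynomials $$\Psi_n(x)=\sqrt{\frac{\Gamma(\alpha+n+1)}{n!\,\Gamma(\alpha+1)}}\;{}_1F_1(-n;\alpha+1;x),\qquad n\ge 0 .$$ They are orthonormal in $\mathcal H$ and satisfy $x\Psi_n=b_n\Psi_{n+1}+a_n\Psi_n+b_{n-1}\Psi_{n-1}$ (with $b_{-1}=0$), where $a_n=2n+\alpha+1$ and $b_n=-\sqrt{(n+1)(n+\alpha+1)}$. Write $|n\rangle=\Psi_n$, $(\sqrt2\,b_{n-1})!=\prod_{k=0}^{n-1}\sqrt2\,b_k$ and $(2b_{n-1}^2)!=\prod_{k=0}^{n-1}2b_k^2$. For $z\in\mathbb C$ the Glauber–Barut–Girardello coherent state of the Laguerre oscillator is $$|z;\alpha\rangle=\mathcal N(z)^{-1}\sum_{n=0}^\infty\frac{z^n}{(\sqrt2\,b_{n-1})!}\,|n\rangle ,\qquad \mathcal N(z)^2=\sum_{n=0}^\infty\frac{|z|^{2n}}{(2b_{n-1}^2)!}.$$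 Let $I_\alpha(w)=\left(\frac w2\right)^{\alpha}\sum_{n\ge0}\frac{(w/2)^{2n}}{n!\,\Gamma(\alpha+n+1)}$ and $K_\alpha(x)=\int_0^\infty e^{-x\cosh t}\cosh(\alpha t)\,dt$ ($x>0$) be the modified Bessel functions of the first and second kind. All complex powers and square roots below are principal values. Then both series defining $\mathcal N(z)^2$ and $|z;\alpha\rangle$ converge for every $z\in\mathbb C$ (the second one in $\mathcal H$), $\mathcal N(z)^2$ is the squared norm of $\sum_n \frac{z^n}{(\sqrt2 b_{n-1})!}|n\rangle$, the states have norm one, and the following hold. 1. (Normalization.) For $z\neq0$, $\ \mathcal N(z)^2=\left(\dfrac{\sqrt2}{|z|}\right)^{\alpha}\Gamma(\alpha+1)\,I_\alpha(\sqrt2|z|)$. 2. (Closed form.) For $z\ne0$ and $\mu_\alpha$-almost every $x$, $$|z;\alpha\rangle(x)=\sqrt{\frac{\Gamma(\alpha+1)}{x^{\alpha}\,I_\alpha(\sqrt2|z|)}}\;\left(\frac{z}{|z|}\right)^{-\alpha/2}e^{-z/\sqrt2}\,I_\alpha\!\left(2^{3/4}\sqrt{xz}\right).$$ 3. (Overlap.)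 For $z_1,z_2\neq0$, with the inner product conjugate-linear in the first argument, $$\langle z_1;\alpha|z_2;\alpha\rangle=\left(\frac{\overline{z_1}z_2}{|z_1z_2|}\right)^{-\alpha/2}\frac{I_\alpha\!\left(\sqrt2\,\sqrt{\overline{z_1}z_2}\right)}{\sqrt{I_\alpha(\sqrt2|z_1|)\,I_\alpha(\sqrt2|z_2|)}} .$$ 4. (The point $z=0$.) $\mathcal N(0)^2=1$, $|0;\alpha\rangle=\Psi_0=1$, and $\langle 0;\alpha|z;\alpha\rangle=\mathcal N(z)^{-1}$ for all $z\in\mathbb C$, where $\mathcal N(z)>0$. 5. (Resolution of the identity.) With $d\nu(z)=\frac1\pi K_\alpha(\sqrt2|z|)\,I_\alpha(\sqrt2|z|)\,d(\mathrm{Re}\,z)\,d(\mathrm{Im}\,z)$ on $\mathbb C$, $$\int_{\mathbb C}|z;\alpha\rangle\langle z;\alpha|\,d\nu(z)=\mathbb 1$$ in the weak sense: for all $f,g\in\mathcal H$ the function $z\mapsto\langle f|z;\alpha\rangle\langle z;\alpha|g\rangle$ is $\nu$-integrable with integral $\langle f|g\rangle$. -/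

import Mathlib

open MeasureTheory

noncomputable section

namespace LaguerreOscillator

/-- Confluent hypergeometric series `₁F₁(a; c; x) = ∑ₖ (a)ₖ / (c)ₖ · xᵏ / k!`. -/
def hyp1F1 (a c x : ℝ) : ℝ :=
  ∑' k : ℕ, (ascPochhammer ℝ k).eval a / (ascPochhammer ℝ k).eval c * x ^ k / (k.factorial : ℝ)

/-- The probability measure `x ^ α e ^ (-x) dx / Γ(α + 1)` on the half-line `(0, ∞)`. -/
def laguerreMeasure (α : ℝ) : Measure ℝ :=
  (volume.restrict (Set.Ioi 0)).withDensity
    (fun x => ENNReal.ofReal (x ^ α * Real.exp (-x) / Real.Gamma (α + 1)))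

/-- The normalized Laguerre polynomials
`Ψₙ(x) = √(Γ(α + n + 1) / (n! Γ(α + 1))) ₁F₁(-n; α + 1; x)`. -/
def laguerrePsi (α : ℝ) (n : ℕ) (x : ℝ) : ℝ :=
  √(Real.Gamma (α + n + 1) / ((n.factorial : ℝ) * Real.Gamma (α + 1))) *
    hyp1F1 (-(n : ℝ)) (α + 1) x

/-- Diagonal recurrence coefficients `aₙ = 2n + α + 1`. -/
def coeffA (α : ℝ) (n : ℕ) : ℝ := 2 * n + α + 1

/-- Off-diagonal recurrence coefficients `bₙ = -√((n + 1)(n + α + 1))`. -/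
def coeffB (α : ℝ) (n : ℕ) : ℝ := -√(((n : ℝ) + 1) * (n + α + 1))

theorem hyp1F1_neg_nat (n : ℕ) (c x : ℝ) :
    hyp1F1 (-(n : ℝ)) c x = ∑ k ∈ Finset.range (n + 1),
      (ascPochhammer ℝ k).eval (-(n : ℝ)) / (ascPochhammer ℝ k).eval c * x ^ k /
        (k.factorial : ℝ) := by
  unfold hyp1F1
  refine tsum_eq_sum ?_
  intro k hk
  have hk' : n < k := by simpa [Nat.lt_succ_iff] using hk
  simp [ascPochhammer_eval_neg_coe_nat_of_lt hk']

theorem memLp_pow {α : ℝ} (hα : -1 < α) (k : ℕ) :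
    MemLp (fun x : ℝ => ((x ^ k : ℝ) : ℂ)) 2 (laguerreMeasure α) := by
  have hmeas : Measurable (fun x : ℝ => ((x ^ k : ℝ) : ℂ)) := by fun_prop
  rw [memLp_two_iff_integrable_sq_norm hmeas.aestronglyMeasurable]
  unfold laguerreMeasure
  rw [integrable_withDensity_iff (by fun_prop) (by simp)]
  have h := Real.GammaIntegral_convergent (s := 2 * k + α + 1)
    (by have : (0 : ℝ) ≤ k := k.cast_nonneg
        linarith)
  have h2 := h.div_const (Real.Gamma (α + 1))
  refine (integrableOn_congr_fun ?_ measurableSet_Ioi).mp h2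
  intro x hx
  have hx : 0 < x := hx
  have hG : 0 < Real.Gamma (α + 1) := Real.Gamma_pos_of_pos (by linarith)
  have e : x ^ (2 * (k : ℝ) + α + 1 - 1) = (x ^ k) ^ 2 * x ^ α := by
    rw [show 2 * (k : ℝ) + α + 1 - 1 = ((k * 2 : ℕ) : ℝ) + α by push_cast; ring,
      Real.rpow_add hx, Real.rpow_natCast, pow_mul]
  simp only [Complex.norm_real, Real.norm_eq_abs, sq_abs]
  rw [ENNReal.toReal_ofReal (by positivity), e]
  ring

theorem memLp_laguerrePsi {α : ℝ} (hα : -1 < α) (n : ℕ) :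
    MemLp (fun x : ℝ => (laguerrePsi α n x : ℂ)) 2 (laguerreMeasure α) := by
  have h : (fun x : ℝ => (laguerrePsi α n x : ℂ)) = fun x : ℝ =>
      ∑ k ∈ Finset.range (n + 1),
        ((√(Real.Gamma (α + n + 1) / ((n.factorial : ℝ) * Real.Gamma (α + 1))) *
          ((ascPochhammer ℝ k).eval (-(n : ℝ)) / (ascPochhammer ℝ k).eval (α + 1) /
            (k.factorial : ℝ)) : ℝ) : ℂ) * ((x ^ k : ℝ) : ℂ) := by
    funext x
    rw [laguerrePsi, hyp1F1_neg_nat, Finset.mul_sum, Complex.ofReal_sum]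
    refine Finset.sum_congr rfl fun k _ => ?_
    rw [← Complex.ofReal_mul]
    congr 1
    ring
  rw [h]
  exact memLp_finsetSum _ fun k _ => (memLp_pow hα k).const_mul _

/-- The Fock space `L²(ℝ; μ_α)` of the Laguerre oscillator (complex-valued functions). -/
abbrev FockSpace (α : ℝ) : Type := Lp ℂ 2 (laguerreMeasure α)

/-- The basis state `|n⟩ = Ψₙ`, as an element of the Fock space. -/
def fock {α : ℝ} (hα : -1 < α) (n : ℕ) : FockSpace α := (memLp_laguerrePsi hα n).toLp _

/-- The generalized factorial `(√2 bₙ₋₁)! = (√2 b₀)(√2 b₁) ⋯ (√2 bₙ₋₁)`, equal to `1` at `n = 0`. -/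
def genFactorial (α : ℝ) (n : ℕ) : ℝ := ∏ k ∈ Finset.range n, (√2 * coeffB α k)

/-- The terms of the unnormalized coherent state `∑ₙ zⁿ / (√2 bₙ₋₁)! |n⟩`. -/
def coherentTerm {α : ℝ} (hα : -1 < α) (z : ℂ) (n : ℕ) : FockSpace α :=
  (z ^ n / (genFactorial α n : ℂ)) • fock hα n

/-- The unnormalized coherent state `∑ₙ zⁿ / (√2 bₙ₋₁)! |n⟩`, a series in the Fock space. -/
def preCoherent {α : ℝ} (hα : -1 < α) (z : ℂ) : FockSpace α := ∑' n : ℕ, coherentTerm hα z n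

/-- The terms `|z|²ⁿ / (2 bₙ₋₁²)!` of the squared normalizing factor. -/
def normSqTerm (α : ℝ) (z : ℂ) (n : ℕ) : ℝ :=
  ‖z‖ ^ (2 * n) / ∏ k ∈ Finset.range n, (2 * coeffB α k ^ 2)

/-- The squared normalizing factor `𝒩² = ∑ₙ |z|²ⁿ / (2 bₙ₋₁²)!`. -/
def normSq (α : ℝ) (z : ℂ) : ℝ := ∑' n : ℕ, normSqTerm α z n

/-- The normalized Glauber–Barut–Girardello coherent state
`|z; α⟩ = 𝒩⁻¹ ∑ₙ zⁿ / (√2 bₙ₋₁)! |n⟩`. -/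
def coherent {α : ℝ} (hα : -1 < α) (z : ℂ) : FockSpace α :=
  (((√(normSq α z))⁻¹ : ℝ) : ℂ) • preCoherent hα z

/-- The modified Bessel function of the first kind
`I_α(w) = (w/2)^α ∑ₙ (w/2)²ⁿ / (n! Γ(α + n + 1))`, with the principal branch of the power. -/
def besselI (α : ℝ) (w : ℂ) : ℂ :=
  (w / 2) ^ (α : ℂ) *
    ∑' n : ℕ, (w / 2) ^ (2 * n) / ((n.factorial : ℂ) * (Real.Gamma (α + n + 1) : ℂ))

/-- The function `I_α` on the nonnegative half-line, as a real-valued function. -/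
def besselIReal (α x : ℝ) : ℝ :=
  (x / 2) ^ α * ∑' n : ℕ, (x / 2) ^ (2 * n) / ((n.factorial : ℝ) * Real.Gamma (α + n + 1))

theorem ofReal_besselIReal (α : ℝ) {x : ℝ} (hx : 0 ≤ x) :
    (besselIReal α x : ℂ) = besselI α x := by
  rw [besselIReal, besselI, Complex.ofReal_mul, Complex.ofReal_cpow (by positivity),
    Complex.ofReal_tsum]
  push_cast
  rfl

/-- The modified Bessel function of the second kind (Macdonald function), for `x > 0`:
`K_α(x) = ∫₀^∞ e^(-x cosh t) cosh (α t) dt`. -/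
def besselK (α x : ℝ) : ℝ :=
  ∫ t in Set.Ioi (0 : ℝ), Real.exp (-x * Real.cosh t) * Real.cosh (α * t)

/-- The measure `dν(z) = π⁻¹ K_α(√2 |z|) I_α(√2 |z|) d(Re z) d(Im z)` on `ℂ`. -/
def coherentMeasure (α : ℝ) : Measure ℂ :=
  volume.withDensity (fun z =>
    ENNReal.ofReal (1 / Real.pi * besselK α (√2 * ‖z‖) * besselIReal α (√2 * ‖z‖)))

end LaguerreOscillator

end

/-!
The coherent states are handled through one entire function, the hypergeometric series
`₀F₁(; c; w)` with `c = α + 1`, to which `I_α` reduces up to a power of `w`.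

*Laguerre system.* With the moments `∫ xᵏ dμ_α = (α + 1)ₖ`, the integral of `xᵐ ₁F₁(-n; α + 1; x)`
is an `n`-th finite difference of a polynomial of degree `m`, so it vanishes for `m < n`; this gives
`orthonormal_fock`. The three-term recurrence is a contiguity relation between Kummer polynomials
(`mul_kummer`). The system is complete (`eq_zero_of_inner_fock_eq_zero`): a vector orthogonal to it
is orthogonal to all powers of `x` and integrable against exponentials, and finite measures with
exponential moments near `0` are determined by their moments (`measure_ext_of_integral_pow_eq`).

*Norm, overlap, closed form.* Since `(√2 bₙ₋₁)!² = 2ⁿ n! (α + 1)ₙ`, the inner product of two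
unnormalized states is `₀F₁(; α + 1; z̄₁ z₂ / 2)` (`inner_preCoherent`), and the generating function
of the Kummer polynomials, a Cauchy product with the exponential series, sums the state pointwise
(`preCoherent_ae_eq`). The passage to `I_α` only requires following the principal branches, which is
done once in `cpow_div_norm_mul_cpow_sqrt`.

*Resolution of the identity.* The functions `z ↦ ⟨z; α|n⟩` are orthonormal in `L²(ν)`: polar
coordinates give orthogonality, and the norms are the moments of `K_α`
(`integral_rpow_mul_besselK`), computed by Fubini's theorem from the representation of `K_α` as a
Gaussian-type integral. Hence the map `f ↦ ⟨z; α|f⟩` is an isometry from the Fock space into `L²(ν)`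
(`coherentTransform`), and the resolution of the identity says that it preserves inner products.
-/

namespace LaguerreOscillator

/-! ### Rising factorials and Kummer polynomials -/

/-- The rising factorial `(c)ₖ = c (c + 1) ⋯ (c + k - 1)`. -/
noncomputable def risingFactorial (c : ℝ) (k : ℕ) : ℝ := (ascPochhammer ℝ k).eval c

@[simp] lemma risingFactorial_zero (c : ℝ) : risingFactorial c 0 = 1 := by
  simp [risingFactorial]

lemma risingFactorial_succ (c : ℝ) (k : ℕ) :
    risingFactorial c (k + 1) = risingFactorial c k * (c + k) :=
  ascPochhammer_succ_eval k c

lemma risingFactorial_pos {c : ℝ} (hc : 0 < c) (k : ℕ) : 0 < risingFactorial c k :=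
  ascPochhammer_pos k c hc

lemma risingFactorial_add (c : ℝ) (k m : ℕ) :
    risingFactorial c (k + m) = risingFactorial c k * (ascPochhammer ℝ m).eval (c + k) := by
  rw [risingFactorial, ← ascPochhammer_mul]
  simp [risingFactorial]

lemma Gamma_add_natCast {c : ℝ} (hc : 0 < c) (n : ℕ) :
    Real.Gamma (c + n) = risingFactorial c n * Real.Gamma c := by
  induction n with
  | zero => simp
  | succ n ih =>
    rw [Nat.cast_succ, ← add_assoc, Real.Gamma_add_one (by positivity), ih, risingFactorial_succ]
    ring

lemma ascPochhammer_eval_neg_natCast (n k : ℕ) :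
    (ascPochhammer ℝ k).eval (-(n : ℝ)) = (-1) ^ k * (k.factorial * n.choose k) := by
  rw [ascPochhammer_eval_neg_eq_descPochhammer, descPochhammer_eval_eq_descFactorial,
    Nat.descFactorial_eq_factorial_mul_choose]
  push_cast
  rfl

/-- The Kummer polynomial `₁F₁(-n; c; x)`, written with binomial coefficients. -/
noncomputable def kummer (c : ℝ) (n : ℕ) (x : ℝ) : ℝ :=
  ∑ k ∈ Finset.range (n + 1), (-1) ^ k * n.choose k / risingFactorial c k * x ^ k

lemma hyp1F1_eq_kummer (n : ℕ) (c x : ℝ) : hyp1F1 (-(n : ℝ)) c x = kummer c n x := by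
  rw [hyp1F1_neg_nat, kummer]
  refine Finset.sum_congr rfl fun k _ => ?_
  have : (k.factorial : ℝ) ≠ 0 := by positivity
  rw [ascPochhammer_eval_neg_natCast, risingFactorial]
  field_simp

/-- The sum may be extended over any longer range, the binomial coefficients being zero there. -/
lemma kummer_eq_sum_range {n N : ℕ} (h : n < N) (c x : ℝ) :
    kummer c n x = ∑ k ∈ Finset.range N, (-1) ^ k * n.choose k / risingFactorial c k * x ^ k := by
  refine Finset.sum_subset (Finset.range_subset_range.2 h) fun k _ hk => ?_
  simp only [Finset.mem_range, not_lt] at hk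
  simp [Nat.choose_eq_zero_of_lt hk]

@[simp] lemma kummer_zero (c x : ℝ) : kummer c 0 x = 1 := by simp [kummer]

lemma laguerrePsi_eq {α : ℝ} (hα : -1 < α) (n : ℕ) (x : ℝ) :
    laguerrePsi α n x = √(risingFactorial (α + 1) n / n.factorial) * kummer (α + 1) n x := by
  have hG := Real.Gamma_pos_of_pos (show 0 < α + 1 by linarith)
  rw [laguerrePsi, hyp1F1_eq_kummer, show α + n + 1 = α + 1 + n by ring,
    Gamma_add_natCast (by linarith), mul_div_mul_right _ _ hG.ne']

/-- The contiguity relation behind the three-term recurrence. At `n = 0` the last term vanishes,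
so the truncated value of `n - 1` is irrelevant. -/
lemma mul_kummer {c : ℝ} (hc : 0 < c) (n : ℕ) (x : ℝ) :
    x * kummer c n x = -(n + c) * kummer c (n + 1) x + (2 * n + c) * kummer c n x
      - n * kummer c (n - 1) x := by
  conv_lhs => rw [kummer]
  rw [kummer_eq_sum_range (show n + 1 < n + 2 by omega),
    kummer_eq_sum_range (show n < n + 2 by omega),
    kummer_eq_sum_range (show n - 1 < n + 2 by omega),
    Finset.mul_sum, Finset.mul_sum, Finset.mul_sum, Finset.mul_sum, ← Finset.sum_add_distrib,
    ← Finset.sum_sub_distrib, Finset.sum_range_succ' _ (n + 1)]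
  simp only [Nat.choose_zero_right, pow_zero, risingFactorial_zero, Nat.cast_one]
  have h0 : -(n + c) * (1 * 1 / 1 * 1) + (2 * n + c) * (1 * 1 / 1 * 1) - n * (1 * 1 / 1 * 1) =
      0 := by ring
  rw [h0, add_zero]
  -- the constant terms cancel; what remains is a comparison of the coefficients of `x ^ (k + 1)`
  refine Finset.sum_congr rfl fun k _ => ?_
  have hk : c + k ≠ 0 := by positivity
  have hp := (risingFactorial_pos hc k).ne'
  have e1 : (n : ℝ) * ((n - 1).choose (k + 1) : ℝ) = (n - (k + 1)) * (n.choose (k + 1) : ℝ) := by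
    rcases n with _ | n
    · simp
    · rcases le_or_gt k n with h | h
      · have := Nat.choose_mul_succ_eq n (k + 1)
        rw [Nat.add_sub_add_right] at this
        have h2 : ((n.choose (k + 1) * (n + 1) : ℕ) : ℝ) =
            ((n + 1).choose (k + 1) * (n - k) : ℕ) := by
          exact_mod_cast this
        push_cast [Nat.cast_sub h] at h2 ⊢
        linarith
      · simp [Nat.choose_eq_zero_of_lt (show n < k + 1 by omega),
          Nat.choose_eq_zero_of_lt (show n + 1 < k + 1 by omega)]
  have e2 : ((k : ℝ) + 1) * (n.choose (k + 1) : ℝ) = (n - k) * (n.choose k : ℝ) := by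
    rcases le_or_gt k n with h | h
    · have := Nat.choose_succ_right_eq n k
      have h2 : ((n.choose (k + 1) * (k + 1) : ℕ) : ℝ) = (n.choose k * (n - k) : ℕ) := by
        exact_mod_cast this
      push_cast [Nat.cast_sub h] at h2
      linarith
    · simp [Nat.choose_eq_zero_of_lt h, Nat.choose_eq_zero_of_lt (show n < k + 1 by omega)]
  rw [risingFactorial_succ, Nat.choose_succ_succ' n k]
  push_cast
  have key : -(c + k) * (n.choose k : ℝ) = -(n + c) * (n.choose k + n.choose (k + 1))
      + (2 * n + c) * n.choose (k + 1) - n * ((n - 1).choose (k + 1) : ℝ) := by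
    rw [e1]; linarith
  field_simp
  linear_combination -((-(1 : ℝ)) ^ k * x ^ k * x) * key

/-- The off-diagonal coefficient converts the normalizing factor of `Ψₘ` into that of `Ψₘ₊₁`. -/
lemma coeffB_mul_sqrt {α : ℝ} (hα : -1 < α) (m : ℕ) :
    coeffB α m * √(risingFactorial (α + 1) m / m.factorial) =
      -(m + 1) * √(risingFactorial (α + 1) (m + 1) / (m + 1).factorial) := by
  have h1 := risingFactorial_pos (show 0 < α + 1 by linarith) m
  have hc : 0 < α + 1 := by linarith
  have h2 : 0 < (m : ℝ) + (α + 1) := by positivity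
  rw [coeffB, neg_mul, ← Real.sqrt_mul (by nlinarith), neg_mul, neg_inj, risingFactorial_succ,
    Nat.factorial_succ]
  conv_rhs => rw [← Real.sqrt_sq (show 0 ≤ (m : ℝ) + 1 by positivity),
    ← Real.sqrt_mul (by positivity)]
  congr 1
  push_cast
  field_simp
  ring

lemma mul_laguerrePsi {α : ℝ} (hα : -1 < α) (n : ℕ) (x : ℝ) :
    x * laguerrePsi α n x = coeffB α n * laguerrePsi α (n + 1) x + coeffA α n * laguerrePsi α n x +
      (if n = 0 then 0 else coeffB α (n - 1) * laguerrePsi α (n - 1) x) := by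
  have hc : 0 < α + 1 := by linarith
  have up (m : ℕ) : coeffB α m * √(risingFactorial (α + 1) (m + 1) / (m + 1).factorial)
      = -(m + (α + 1)) * √(risingFactorial (α + 1) m / m.factorial) := by
    have h1 := risingFactorial_pos hc m
    have h2 : 0 < (m : ℝ) + (α + 1) := by positivity
    rw [coeffB, neg_mul, ← Real.sqrt_mul (by nlinarith), neg_mul, neg_inj, risingFactorial_succ,
      Nat.factorial_succ]
    conv_rhs => rw [← Real.sqrt_sq h2.le, ← Real.sqrt_mul (by positivity)]
    congr 1
    push_cast
    field_simp
    ring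
  simp only [laguerrePsi_eq hα]
  rw [mul_left_comm, mul_kummer hc, ← mul_assoc (coeffB α n), up n, coeffA]
  rcases n with _ | n
  · simp
  · simp only [Nat.add_sub_cancel, Nat.add_eq_zero_iff, one_ne_zero, and_false, if_false]
    rw [← mul_assoc (coeffB α n), coeffB_mul_sqrt hα n]
    push_cast
    ring

/-! ### Orthonormality of the Laguerre system -/

lemma integral_laguerreMeasure {E : Type*} [NormedAddCommGroup E] [NormedSpace ℝ E] {α : ℝ}
    (hα : -1 < α) (f : ℝ → E) :
    ∫ x, f x ∂laguerreMeasure α =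
      ∫ x in Set.Ioi 0, (x ^ α * Real.exp (-x) / Real.Gamma (α + 1)) • f x := by
  have hG := Real.Gamma_pos_of_pos (show 0 < α + 1 by linarith)
  rw [laguerreMeasure, integral_withDensity_eq_integral_toReal_smul (by fun_prop) (by simp)]
  refine setIntegral_congr_fun measurableSet_Ioi fun x hx => ?_
  have hx : 0 < x := hx
  rw [ENNReal.toReal_ofReal (by positivity)]

lemma integral_pow_laguerreMeasure {α : ℝ} (hα : -1 < α) (k : ℕ) :
    ∫ x, x ^ k ∂laguerreMeasure α = risingFactorial (α + 1) k := by
  have hG := Real.Gamma_pos_of_pos (show 0 < α + 1 by linarith)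
  have h1 : 0 < α + 1 + k := add_pos_of_pos_of_nonneg (by linarith) k.cast_nonneg
  rw [integral_laguerreMeasure hα, ← mul_div_cancel_right₀ (risingFactorial (α + 1) k) hG.ne',
    ← Gamma_add_natCast (by linarith), Real.Gamma_eq_integral h1, ← integral_div]
  refine setIntegral_congr_fun measurableSet_Ioi fun x hx => ?_
  have hx : 0 < x := hx
  simp only [smul_eq_mul]
  rw [show α + 1 + k - 1 = α + k by ring, Real.rpow_add hx, Real.rpow_natCast]
  ring

lemma isProbabilityMeasure_laguerreMeasure {α : ℝ} (hα : -1 < α) :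
    IsProbabilityMeasure (laguerreMeasure α) := by
  have h := integral_pow_laguerreMeasure hα 0
  simp only [pow_zero, integral_const, smul_eq_mul, mul_one, risingFactorial_zero] at h
  exact ⟨by rw [← ENNReal.toReal_eq_one_iff]; exact h⟩

lemma integrable_pow_laguerreMeasure {α : ℝ} (hα : -1 < α) (k : ℕ) :
    Integrable (fun x => x ^ k) (laguerreMeasure α) :=
  -- a non-integrable function would have integral zero
  .of_integral_ne_zero (by
    rw [integral_pow_laguerreMeasure hα]
    exact (risingFactorial_pos (by linarith) k).ne')

/-- After integration, the alternating sum is an `n`-th finite difference of the polynomial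
`y ↦ (y)ₘ` of degree `m`. -/
lemma integral_pow_mul_kummer {α : ℝ} (hα : -1 < α) (m n : ℕ) :
    ∫ x, x ^ m * kummer (α + 1) n x ∂laguerreMeasure α =
      (-1) ^ n * ((fwdDiff (1 : ℝ))^[n] (ascPochhammer ℝ m).eval) (α + 1) := by
  have e (x : ℝ) : x ^ m * kummer (α + 1) n x = ∑ k ∈ Finset.range (n + 1),
      (-1) ^ k * n.choose k / risingFactorial (α + 1) k * x ^ (k + m) := by
    rw [kummer, Finset.mul_sum]
    refine Finset.sum_congr rfl fun k _ => ?_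
    ring
  simp_rw [e]
  rw [integral_finsetSum _ fun k _ => (integrable_pow_laguerreMeasure hα _).const_mul _,
    fwdDiff_iter_eq_sum_shift, Finset.mul_sum]
  refine Finset.sum_congr rfl fun k hk => ?_
  have hp := (risingFactorial_pos (show 0 < α + 1 by linarith) k).ne'
  have hk : k ≤ n := by simpa [Nat.lt_succ_iff] using hk
  obtain ⟨j, rfl⟩ := Nat.exists_eq_add_of_le hk
  rw [integral_const_mul, integral_pow_laguerreMeasure hα, risingFactorial_add]
  simp only [Nat.add_sub_cancel_left, nsmul_eq_mul, mul_one, zsmul_eq_mul]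
  push_cast
  have : ((-1 : ℝ)) ^ (k + j) * (-1) ^ j = (-1) ^ k := by
    rw [pow_add, mul_assoc, ← mul_pow]; simp
  rw [← mul_assoc, div_mul_cancel₀ _ hp, ← this]
  ring

lemma integral_pow_mul_kummer_of_lt {α : ℝ} (hα : -1 < α) {m n : ℕ} (h : m < n) :
    ∫ x, x ^ m * kummer (α + 1) n x ∂laguerreMeasure α = 0 := by
  rw [integral_pow_mul_kummer hα, Polynomial.fwdDiff_iter_eq_zero_of_degree_lt (by simpa using h)]
  simp

lemma integral_pow_mul_kummer_self {α : ℝ} (hα : -1 < α) (n : ℕ) :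
    ∫ x, x ^ n * kummer (α + 1) n x ∂laguerreMeasure α = (-1) ^ n * n.factorial := by
  rw [integral_pow_mul_kummer hα]
  have := Polynomial.fwdDiff_iter_degree_eq_factorial (ascPochhammer ℝ n)
  rw [ascPochhammer_natDegree] at this
  rw [this, (monic_ascPochhammer ℝ n).leadingCoeff]
  simp

lemma integrable_pow_mul_kummer {α : ℝ} (hα : -1 < α) (m n : ℕ) :
    Integrable (fun x => x ^ m * kummer (α + 1) n x) (laguerreMeasure α) := by
  have e : (fun x : ℝ => x ^ m * kummer (α + 1) n x) = fun x => ∑ k ∈ Finset.range (n + 1),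
      (-1) ^ k * n.choose k / risingFactorial (α + 1) k * x ^ (k + m) := by
    funext x
    rw [kummer, Finset.mul_sum]
    refine Finset.sum_congr rfl fun k _ => ?_
    ring
  rw [e]
  exact integrable_finsetSum _ fun k _ => (integrable_pow_laguerreMeasure hα _).const_mul _

lemma integral_kummer_mul_kummer {α : ℝ} (hα : -1 < α) {m n : ℕ} (h : m ≤ n) :
    ∫ x, kummer (α + 1) m x * kummer (α + 1) n x ∂laguerreMeasure α =
      if m = n then n.factorial / risingFactorial (α + 1) n else 0 := by
  have e (x : ℝ) : kummer (α + 1) m x * kummer (α + 1) n x = ∑ k ∈ Finset.range (m + 1),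
      (-1) ^ k * m.choose k / risingFactorial (α + 1) k * (x ^ k * kummer (α + 1) n x) := by
    rw [kummer, Finset.sum_mul]
    refine Finset.sum_congr rfl fun k _ => ?_
    ring
  simp_rw [e]
  rw [integral_finsetSum _ fun k _ => (integrable_pow_mul_kummer hα _ _).const_mul _]
  simp_rw [integral_const_mul]
  -- only the top power of the first factor survives
  rw [Finset.sum_range_succ, Finset.sum_eq_zero, zero_add]
  · split_ifs with hmn
    · subst hmn
      rw [integral_pow_mul_kummer_self hα, Nat.choose_self]
      have : ((-1 : ℝ)) ^ m * (-1) ^ m = 1 := by rw [← mul_pow]; simp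
      linear_combination (m.factorial / risingFactorial (α + 1) m) * this
    · rw [integral_pow_mul_kummer_of_lt hα (by omega), mul_zero]
  · intro k hk
    rw [integral_pow_mul_kummer_of_lt hα (by simp at hk; omega), mul_zero]

lemma integral_laguerrePsi_mul {α : ℝ} (hα : -1 < α) (m n : ℕ) :
    ∫ x, laguerrePsi α m x * laguerrePsi α n x ∂laguerreMeasure α = if m = n then 1 else 0 := by
  wlog h : m ≤ n generalizing m n
  · simp_rw [mul_comm (laguerrePsi α m _), eq_comm (a := m)]
    exact this n m (by omega)
  have e (x : ℝ) : laguerrePsi α m x * laguerrePsi α n x =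
      √(risingFactorial (α + 1) m / m.factorial) * √(risingFactorial (α + 1) n / n.factorial) *
        (kummer (α + 1) m x * kummer (α + 1) n x) := by
    rw [laguerrePsi_eq hα, laguerrePsi_eq hα]; ring
  simp_rw [e]
  rw [integral_const_mul, integral_kummer_mul_kummer hα h]
  split_ifs with hmn
  · subst hmn
    have := risingFactorial_pos (show 0 < α + 1 by linarith) m
    rw [Real.mul_self_sqrt (by positivity)]
    field_simp
  · simp

lemma coeFn_fock {α : ℝ} (hα : -1 < α) (n : ℕ) :
    (fock hα n : ℝ → ℂ) =ᵐ[laguerreMeasure α] fun x => (laguerrePsi α n x : ℂ) :=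
  MemLp.coeFn_toLp _

lemma orthonormal_fock {α : ℝ} (hα : -1 < α) : Orthonormal ℂ (fock hα) := by
  rw [orthonormal_iff_ite]
  intro m n
  rw [L2.inner_def]
  have : ∀ᵐ x ∂laguerreMeasure α, inner ℂ (fock hα m x) (fock hα n x) =
      ((laguerrePsi α m x * laguerrePsi α n x : ℝ) : ℂ) := by
    filter_upwards [coeFn_fock hα m, coeFn_fock hα n] with x h1 h2
    rw [h1, h2, RCLike.inner_apply, Complex.conj_ofReal, Complex.ofReal_mul, mul_comm]
  rw [integral_congr_ae this, integral_complex_ofReal, integral_laguerrePsi_mul hα]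
  split_ifs <;> simp

/-! ### Completeness of the Laguerre system -/

/-- Two finite measures on the line with exponential moments near `0` and the same moments agree:
their moment generating functions have the same Taylor series at `0`, hence coincide on a vertical
strip around the imaginary axis, and on that axis they are the characteristic functions. -/
lemma measure_ext_of_integral_pow_eq {μ ν : Measure ℝ} [IsFiniteMeasure μ] [IsFiniteMeasure ν]
    (hμ : 0 ∈ interior (ProbabilityTheory.integrableExpSet id μ))
    (hν : 0 ∈ interior (ProbabilityTheory.integrableExpSet id ν))
    (h : ∀ n : ℕ, ∫ x, x ^ n ∂μ = ∫ x, x ^ n ∂ν) : μ = ν := by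
  set A := interior (ProbabilityTheory.integrableExpSet id μ)
  set B := interior (ProbabilityTheory.integrableExpSet id ν)
  set S : Set ℂ := {z | z.re ∈ A ∩ B}
  have hS : IsPreconnected S := by
    have hAB : Convex ℝ (A ∩ B) :=
      ProbabilityTheory.convex_integrableExpSet.interior.inter
        ProbabilityTheory.convex_integrableExpSet.interior
    exact (hAB.linear_preimage Complex.reLm).isPreconnected
  have h0 : (0 : ℂ) ∈ S := ⟨by simpa using hμ, by simpa using hν⟩
  have aμ : AnalyticOnNhd ℂ (ProbabilityTheory.complexMGF id μ) S :=
    ProbabilityTheory.analyticOnNhd_complexMGF.mono fun z hz => hz.1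
  have aν : AnalyticOnNhd ℂ (ProbabilityTheory.complexMGF id ν) S :=
    ProbabilityTheory.analyticOnNhd_complexMGF.mono fun z hz => hz.2
  have hd (n : ℕ) : iteratedDeriv n (ProbabilityTheory.complexMGF id μ) 0 =
      iteratedDeriv n (ProbabilityTheory.complexMGF id ν) 0 := by
    rw [ProbabilityTheory.iteratedDeriv_complexMGF (by simpa using hμ),
      ProbabilityTheory.iteratedDeriv_complexMGF (by simpa using hν)]
    have e (ρ : Measure ℝ) : ∫ x, ((id x : ℝ) : ℂ) ^ n * Complex.exp (0 * ((id x : ℝ) : ℂ)) ∂ρ =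
        ((∫ x, x ^ n ∂ρ : ℝ) : ℂ) := by
      rw [← integral_complex_ofReal]
      simp
    rw [e, e, h]
  have hev : ProbabilityTheory.complexMGF id μ =ᶠ[nhds 0] ProbabilityTheory.complexMGF id ν := by
    have p1 := (aμ 0 h0).hasFPowerSeriesAt
    have p2 := (aν 0 h0).hasFPowerSeriesAt
    simp_rw [hd] at p1
    have p3 := p1.sub p2
    rw [sub_self] at p3
    filter_upwards [p3.eventually_eq_zero] with z hz
    exact sub_eq_zero.1 hz
  have hEq := aμ.eqOn_of_preconnected_of_eventuallyEq aν hS h0 hev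
  refine Measure.ext_of_charFun (funext fun t => ?_)
  rw [← ProbabilityTheory.complexMGF_id_mul_I, ← ProbabilityTheory.complexMGF_id_mul_I]
  exact hEq ⟨by simpa using hμ, by simpa using hν⟩

/-- A function integrable against exponentials and with vanishing moments is zero: its positive
and negative parts are densities of measures with equal moments. -/
lemma ae_eq_zero_of_integral_pow_mul_eq_zero {μ : Measure ℝ} [IsFiniteMeasure μ] {f : ℝ → ℝ}
    (hf : Measurable f) {δ : ℝ} (hδ : 0 < δ)
    (hexp : ∀ t < δ, Integrable (fun x => Real.exp (t * x) * f x) μ)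
    (hint : ∀ n : ℕ, Integrable (fun x => x ^ n * f x) μ)
    (h : ∀ n : ℕ, ∫ x, x ^ n * f x ∂μ = 0) : f =ᵐ[μ] 0 := by
  have hf1 : Integrable f μ := by simpa using hint 0
  -- `ENNReal.ofReal` truncates at `0`, so `s = f` and `s = -f` give the densities `f⁺` and `f⁻`
  have hpart (g : ℝ → ℝ) (hg : Measurable g) (s : ℝ → ℝ) (hs : ∀ x, |s x| = |f x|)
      (hsm : Measurable s) (hgf : Integrable (fun x => g x * f x) μ) :
      Integrable g (μ.withDensity fun x => ENNReal.ofReal (s x)) := by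
    rw [integrable_withDensity_iff (by fun_prop) (by simp)]
    refine hgf.mono (by fun_prop) (.of_forall fun x => ?_)
    rw [norm_mul, norm_mul]
    gcongr
    rw [ENNReal.toReal_ofReal', Real.norm_eq_abs, Real.norm_eq_abs, ← hs x,
      abs_of_nonneg (le_max_right _ _)]
    exact max_le (le_abs_self _) (abs_nonneg _)
  set μ₁ := μ.withDensity fun x => ENNReal.ofReal (f x) with hμ₁
  set μ₂ := μ.withDensity fun x => ENNReal.ofReal (-f x) with hμ₂
  have h₁ (g : ℝ → ℝ) (hg : Measurable g) (hgf : Integrable (fun x => g x * f x) μ) :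
      Integrable g μ₁ := hpart g hg f (fun _ => rfl) hf hgf
  have h₂ (g : ℝ → ℝ) (hg : Measurable g) (hgf : Integrable (fun x => g x * f x) μ) :
      Integrable g μ₂ := hpart g hg (fun x => -f x) (fun x => abs_neg _) hf.neg hgf
  have hfin₁ : IsFiniteMeasure μ₁ := isFiniteMeasure_withDensity_ofReal hf1.2
  have hfin₂ : IsFiniteMeasure μ₂ := isFiniteMeasure_withDensity_ofReal hf1.neg.2
  have heq : μ₁ = μ₂ := by
    refine measure_ext_of_integral_pow_eq ?_ ?_ fun n => ?_
    · refine mem_interior.2 ⟨Set.Iio δ, fun t ht => ?_, isOpen_Iio, hδ⟩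
      exact h₁ _ (by fun_prop) (hexp t ht)
    · refine mem_interior.2 ⟨Set.Iio δ, fun t ht => ?_, isOpen_Iio, hδ⟩
      exact h₂ _ (by fun_prop) (hexp t ht)
    · have i₁ := h₁ (fun x => x ^ n) (by fun_prop) (hint n)
      have i₂ := h₂ (fun x => x ^ n) (by fun_prop) (hint n)
      rw [hμ₁, integrable_withDensity_iff (by fun_prop) (by simp)] at i₁
      rw [hμ₂, integrable_withDensity_iff (by fun_prop) (by simp)] at i₂
      rw [hμ₁, hμ₂, integral_withDensity_eq_integral_toReal_smul (by fun_prop) (by simp),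
        integral_withDensity_eq_integral_toReal_smul (by fun_prop) (by simp), ← sub_eq_zero]
      simp_rw [smul_eq_mul, mul_comm _ (_ ^ n)]
      rw [← integral_sub i₁ i₂, ← h n]
      refine integral_congr_ae (.of_forall fun x => ?_)
      simp only [ENNReal.toReal_ofReal']
      rw [← mul_sub, max_zero_sub_max_neg_zero_eq_self]
  have hae := (withDensity_eq_iff (by fun_prop) (by fun_prop) (by
    have := hfin₁.measure_univ_lt_top
    rw [hμ₁, withDensity_apply _ .univ, Measure.restrict_univ] at this
    exact this.ne)).1 heq
  filter_upwards [hae] with x hx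
  have hx' := congrArg ENNReal.toReal hx
  simp only [ENNReal.toReal_ofReal'] at hx'
  rcases le_total (f x) 0 with h0 | h0
  · rw [max_eq_right h0, max_eq_left (by linarith)] at hx'
    simp only [Pi.zero_apply]; linarith
  · rw [max_eq_left h0, max_eq_right (by linarith)] at hx'
    simpa using hx'

lemma memLp_exp_laguerreMeasure {α : ℝ} (hα : -1 < α) {t : ℝ} (ht : t < 1 / 2) :
    MemLp (fun x : ℝ => Real.exp (t * x)) 2 (laguerreMeasure α) := by
  rw [memLp_two_iff_integrable_sq_norm (by fun_prop)]
  unfold laguerreMeasure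
  rw [integrable_withDensity_iff (by fun_prop) (by simp)]
  have hG := Real.Gamma_pos_of_pos (show 0 < α + 1 by linarith)
  have h := (integrableOn_rpow_mul_exp_neg_mul_rpow (p := 1) hα one_pos
    (show 0 < 1 - 2 * t by linarith)).div_const (Real.Gamma (α + 1))
  refine (integrableOn_congr_fun (fun x hx => ?_) measurableSet_Ioi).mp h
  have hx : 0 < x := hx
  simp only [Real.norm_eq_abs, sq_abs]
  rw [ENNReal.toReal_ofReal (by positivity), Real.rpow_one, ← Real.exp_nat_mul,
    show -(1 - 2 * t) * x = (2 : ℕ) * (t * x) + -x by push_cast; ring, Real.exp_add]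
  ring

lemma memLp_pow_real {α : ℝ} (hα : -1 < α) (n : ℕ) :
    MemLp (fun x : ℝ => x ^ n) 2 (laguerreMeasure α) := by
  simpa only [RCLike.re_eq_complex_re, Complex.ofReal_re] using (memLp_pow hα n).re

lemma inner_fock {α : ℝ} (hα : -1 < α) (n : ℕ) (f : FockSpace α) :
    inner ℂ (fock hα n) f = ∫ x, (laguerrePsi α n x : ℂ) * f x ∂laguerreMeasure α := by
  rw [L2.inner_def]
  refine integral_congr_ae ?_
  filter_upwards [coeFn_fock hα n] with x hx
  rw [hx, RCLike.inner_apply, Complex.conj_ofReal, mul_comm]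

/-- A vector orthogonal to all `Ψₙ` is orthogonal to all `xᵏ Ψₙ`, by induction on `k` through the
three-term recurrence. -/
lemma integral_pow_mul_laguerrePsi_mul {α : ℝ} (hα : -1 < α) {f : FockSpace α}
    (hf : ∀ n, inner ℂ (fock hα n) f = 0) (k n : ℕ) :
    ∫ x, ((x ^ k * laguerrePsi α n x : ℝ) : ℂ) * f x ∂laguerreMeasure α = 0 := by
  have hint (k n : ℕ) : Integrable (fun x => ((x ^ k * laguerrePsi α n x : ℝ) : ℂ) * f x)
      (laguerreMeasure α) := by
    have e : (fun x => ((x ^ k * laguerrePsi α n x : ℝ) : ℂ) * f x) = fun x =>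
        ∑ j ∈ Finset.range (n + 1), ((√(risingFactorial (α + 1) n / n.factorial) *
          ((-1) ^ j * n.choose j / risingFactorial (α + 1) j) : ℝ) : ℂ) *
            (((x ^ (k + j) : ℝ) : ℂ) * f x) := by
      funext x
      rw [laguerrePsi_eq hα, kummer, Finset.mul_sum, Finset.mul_sum, Complex.ofReal_sum,
        Finset.sum_mul]
      refine Finset.sum_congr rfl fun j _ => ?_
      push_cast
      ring
    rw [e]
    exact integrable_finsetSum _ fun j _ =>
      ((memLp_pow hα (k + j)).integrable_mul (Lp.memLp f)).const_mul _
  induction k generalizing n with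
  | zero => simpa [inner_fock] using hf n
  | succ k ih =>
    have e (x : ℝ) : ((x ^ (k + 1) * laguerrePsi α n x : ℝ) : ℂ) * f x =
        (coeffB α n : ℂ) * (((x ^ k * laguerrePsi α (n + 1) x : ℝ) : ℂ) * f x) +
        (coeffA α n : ℂ) * (((x ^ k * laguerrePsi α n x : ℝ) : ℂ) * f x) +
        ((if n = 0 then 0 else coeffB α (n - 1) : ℝ) : ℂ) *
          (((x ^ k * laguerrePsi α (n - 1) x : ℝ) : ℂ) * f x) := by
      rw [pow_succ, mul_assoc, mul_laguerrePsi hα]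
      split_ifs <;> push_cast <;> ring
    simp_rw [e]
    rw [integral_add (by exact ((hint _ _).const_mul _).add ((hint _ _).const_mul _))
      ((hint _ _).const_mul _), integral_add ((hint _ _).const_mul _) ((hint _ _).const_mul _)]
    simp_rw [integral_const_mul, ih]
    simp

lemma laguerrePsi_zero {α : ℝ} (hα : -1 < α) (x : ℝ) : laguerrePsi α 0 x = 1 := by
  simp [laguerrePsi_eq hα]

lemma eq_zero_of_inner_fock_eq_zero {α : ℝ} (hα : -1 < α) {f : FockSpace α}
    (hf : ∀ n, inner ℂ (fock hα n) f = 0) : f = 0 := by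
  have := isProbabilityMeasure_laguerreMeasure hα
  have hz (k : ℕ) : ∫ x, ((x ^ k : ℝ) : ℂ) * f x ∂laguerreMeasure α = 0 := by
    simpa [laguerrePsi_zero hα] using integral_pow_mul_laguerrePsi_mul hα hf k 0
  have hi (k : ℕ) : Integrable (fun x => ((x ^ k : ℝ) : ℂ) * f x) (laguerreMeasure α) :=
    (memLp_pow hα k).integrable_mul (Lp.memLp f)
  have hm : Measurable f := (Lp.stronglyMeasurable f).measurable
  have hre : (fun x => (f x).re) =ᵐ[laguerreMeasure α] 0 := by
    refine ae_eq_zero_of_integral_pow_mul_eq_zero (by fun_prop) one_half_pos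
      (fun t ht => (memLp_exp_laguerreMeasure hα ht).integrable_mul (Lp.memLp f).re)
      (fun n => (memLp_pow_real hα n).integrable_mul (Lp.memLp f).re) fun n => ?_
    have h := congrArg Complex.re (hz n)
    rw [← RCLike.re_eq_complex_re, ← integral_re (hi n)] at h
    simpa [-Complex.ofReal_pow] using h
  have him : (fun x => (f x).im) =ᵐ[laguerreMeasure α] 0 := by
    refine ae_eq_zero_of_integral_pow_mul_eq_zero (by fun_prop) one_half_pos
      (fun t ht => (memLp_exp_laguerreMeasure hα ht).integrable_mul (Lp.memLp f).im)
      (fun n => (memLp_pow_real hα n).integrable_mul (Lp.memLp f).im) fun n => ?_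
    have h := congrArg Complex.im (hz n)
    rw [← RCLike.im_eq_complex_im, ← integral_im (hi n)] at h
    simpa [-Complex.ofReal_pow] using h
  rw [Lp.eq_zero_iff_ae_eq_zero]
  filter_upwards [hre, him] with x h1 h2
  exact Complex.ext h1 h2

/-- The Laguerre system as a Hilbert basis of the Fock space. -/
noncomputable def fockBasis {α : ℝ} (hα : -1 < α) : HilbertBasis ℕ ℂ (FockSpace α) :=
  HilbertBasis.mkOfOrthogonalEqBot (orthonormal_fock hα) (by
    rw [Submodule.eq_bot_iff]
    intro f hf
    refine eq_zero_of_inner_fock_eq_zero hα fun n => ?_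
    exact hf _ (Submodule.subset_span ⟨n, rfl⟩))

@[simp] lemma coe_fockBasis {α : ℝ} (hα : -1 < α) : ⇑(fockBasis hα) = fock hα :=
  HilbertBasis.coe_mkOfOrthogonalEqBot _ _

/-! ### Convergence of the coherent-state series -/

lemma summable_of_succ_eq_mul {f q : ℕ → ℝ} (h : ∀ n, f (n + 1) = q n * f n)
    (hq : Filter.Tendsto q Filter.atTop (nhds 0)) : Summable f := by
  refine summable_of_ratio_norm_eventually_le (r := 1 / 2) (by norm_num) ?_
  have := hq.norm
  rw [norm_zero] at this
  filter_upwards [this.eventually_le_const (show (0 : ℝ) < 1 / 2 by norm_num)] with n hn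
  rw [h, norm_mul]
  gcongr

/-- The hypergeometric function `₀F₁(; c; w) = ∑ₖ wᵏ / (k! (c)ₖ)`. -/
noncomputable def hyp0F1 (c : ℝ) (w : ℂ) : ℂ :=
  ∑' k : ℕ, w ^ k / ((k.factorial : ℂ) * (risingFactorial c k : ℂ))

lemma summable_norm_hyp0F1 {c : ℝ} (hc : 0 < c) (w : ℂ) :
    Summable fun k : ℕ => ‖w ^ k / ((k.factorial : ℂ) * (risingFactorial c k : ℂ))‖ := by
  refine summable_of_succ_eq_mul (q := fun k => ‖w‖ / ((k + 1) * (c + k))) (fun k => ?_) ?_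
  · have h := risingFactorial_pos hc k
    have hk : (0 : ℝ) < c + k := by positivity
    rw [risingFactorial_succ, Nat.factorial_succ]
    simp only [norm_div, norm_mul, norm_pow, Complex.norm_real, Complex.norm_natCast,
      Real.norm_of_nonneg h.le, Real.norm_of_nonneg hk.le]
    push_cast
    field_simp
    ring
  · refine Filter.Tendsto.const_div_atTop ?_ _
    refine Filter.Tendsto.atTop_mul_atTop₀ ?_ ?_
    · exact Filter.tendsto_atTop_add_const_right _ _ tendsto_natCast_atTop_atTop
    · exact Filter.tendsto_atTop_add_const_left _ _ tendsto_natCast_atTop_atTop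

lemma hasSum_hyp0F1 {c : ℝ} (hc : 0 < c) (w : ℂ) :
    HasSum (fun k : ℕ => w ^ k / ((k.factorial : ℂ) * (risingFactorial c k : ℂ))) (hyp0F1 c w) :=
  (summable_norm_hyp0F1 hc w).of_norm.hasSum

/-- The form in which the normalizing factor of `Ψₙ` cancels against the generalized factorial. -/
lemma genFactorial_eq {α : ℝ} (hα : -1 < α) (n : ℕ) :
    genFactorial α n = (-√2) ^ n * n.factorial * √(risingFactorial (α + 1) n / n.factorial) := by
  induction n with
  | zero => simp [genFactorial]
  | succ n ih =>
    have hs : genFactorial α (n + 1) = genFactorial α n * (√2 * coeffB α n) :=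
      Finset.prod_range_succ _ _
    rw [hs, ih, Nat.factorial_succ n]
    have h := coeffB_mul_sqrt hα n
    rw [Nat.factorial_succ] at h
    push_cast at h ⊢
    linear_combination (-√2) ^ n * n.factorial * √2 * h

lemma genFactorial_sq {α : ℝ} (hα : -1 < α) (n : ℕ) :
    genFactorial α n ^ 2 = 2 ^ n * (n.factorial * risingFactorial (α + 1) n) := by
  have h := risingFactorial_pos (show 0 < α + 1 by linarith) n
  rw [genFactorial_eq hα, mul_pow, mul_pow, Real.sq_sqrt (by positivity), ← pow_mul, mul_comm n 2,
    pow_mul, neg_sq, Real.sq_sqrt zero_le_two]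
  field_simp

lemma genFactorial_ne_zero {α : ℝ} (hα : -1 < α) (n : ℕ) : genFactorial α n ≠ 0 := by
  have h := risingFactorial_pos (show 0 < α + 1 by linarith) n
  rw [← sq_pos_iff, genFactorial_sq hα]
  positivity

lemma normSqTerm_eq {α : ℝ} (hα : -1 < α) (z : ℂ) (n : ℕ) :
    normSqTerm α z n = (‖z‖ ^ 2 / 2) ^ n / (n.factorial * risingFactorial (α + 1) n) := by
  have e : ∏ k ∈ Finset.range n, (2 * coeffB α k ^ 2) = genFactorial α n ^ 2 := by
    rw [genFactorial, ← Finset.prod_pow]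
    refine Finset.prod_congr rfl fun k _ => ?_
    rw [mul_pow, Real.sq_sqrt zero_le_two]
  rw [normSqTerm, e, genFactorial_sq hα, div_pow, pow_mul, div_div]

lemma norm_coherentTerm_sq {α : ℝ} (hα : -1 < α) (z : ℂ) (n : ℕ) :
    ‖coherentTerm hα z n‖ ^ 2 = normSqTerm α z n := by
  rw [coherentTerm, norm_smul, (orthonormal_fock hα).1, mul_one, norm_div, norm_pow, div_pow,
    Complex.norm_real, Real.norm_eq_abs, sq_abs, genFactorial_sq hα, normSqTerm_eq hα, div_pow,
    ← pow_mul, mul_comm n 2, pow_mul, div_div]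

lemma ofReal_normSqTerm {α : ℝ} (hα : -1 < α) (z : ℂ) (n : ℕ) :
    (normSqTerm α z n : ℂ) =
      ((‖z‖ ^ 2 / 2 : ℝ) : ℂ) ^ n / ((n.factorial : ℂ) * (risingFactorial (α + 1) n : ℂ)) := by
  rw [normSqTerm_eq hα]
  push_cast
  rfl

lemma summable_normSqTerm {α : ℝ} (hα : -1 < α) (z : ℂ) : Summable (normSqTerm α z) := by
  rw [← Complex.summable_ofReal]
  simp_rw [ofReal_normSqTerm hα]
  exact (hasSum_hyp0F1 (by linarith) _).summable

lemma ofReal_normSq {α : ℝ} (hα : -1 < α) (z : ℂ) :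
    (normSq α z : ℂ) = hyp0F1 (α + 1) ((‖z‖ ^ 2 / 2 : ℝ) : ℂ) := by
  rw [normSq, Complex.ofReal_tsum, hyp0F1]
  simp_rw [ofReal_normSqTerm hα]

lemma normSq_pos {α : ℝ} (hα : -1 < α) (z : ℂ) : 0 < normSq α z := by
  have h : ∀ n, 0 ≤ normSqTerm α z n := fun n => by
    rw [← norm_coherentTerm_sq hα]; positivity
  refine (summable_normSqTerm hα z).tsum_pos h 0 ?_
  simp [normSqTerm]

lemma summable_coherentTerm {α : ℝ} (hα : -1 < α) (z : ℂ) : Summable (coherentTerm hα z) := by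
  refine Summable.of_norm ?_
  refine summable_of_succ_eq_mul (q := fun n => ‖z‖ / (√2 * √(((n : ℝ) + 1) * (n + α + 1))))
    (fun n => ?_) ?_
  · have hs : genFactorial α (n + 1) = genFactorial α n * (√2 * coeffB α n) :=
      Finset.prod_range_succ _ _
    simp only [coherentTerm, norm_smul, (orthonormal_fock hα).1, mul_one, norm_div, norm_pow,
      Complex.norm_real, hs, norm_mul, coeffB, norm_neg,
      Real.norm_of_nonneg (Real.sqrt_nonneg _)]
    rw [pow_succ, mul_comm (‖z‖ ^ n), mul_comm ‖genFactorial α n‖, mul_div_mul_comm]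
  · refine Filter.Tendsto.const_div_atTop ?_ _
    refine Filter.Tendsto.const_mul_atTop (by positivity) ?_
    refine Real.tendsto_sqrt_atTop.comp ?_
    refine Filter.Tendsto.atTop_mul_atTop₀ ?_ ?_
    · exact Filter.tendsto_atTop_add_const_right _ _ tendsto_natCast_atTop_atTop
    · simp_rw [add_assoc]
      exact Filter.tendsto_atTop_add_const_right _ _ tendsto_natCast_atTop_atTop

lemma hasSum_coherentTerm {α : ℝ} (hα : -1 < α) (z : ℂ) :
    HasSum (coherentTerm hα z) (preCoherent hα z) :=
  (summable_coherentTerm hα z).hasSum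

lemma inner_fock_preCoherent {α : ℝ} (hα : -1 < α) (n : ℕ) (z : ℂ) :
    inner ℂ (fock hα n) (preCoherent hα z) = z ^ n / (genFactorial α n : ℂ) := by
  have h := (hasSum_coherentTerm hα z).mapL (innerSL ℂ (fock hα n))
  refine h.unique ?_
  convert! hasSum_ite_eq n (z ^ n / (genFactorial α n : ℂ)) using 2 with m
  rw [innerSL_apply_apply, coherentTerm, inner_smul_right,
    orthonormal_iff_ite.1 (orthonormal_fock hα)]
  by_cases h : n = m
  · subst h; simp
  · simp [h, Ne.symm h]

lemma inner_preCoherent {α : ℝ} (hα : -1 < α) (z w : ℂ) :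
    inner ℂ (preCoherent hα z) (preCoherent hα w) =
      hyp0F1 (α + 1) ((starRingEnd ℂ) z * w / 2) := by
  refine ((fockBasis hα).hasSum_inner_mul_inner _ _).unique ?_
  convert! hasSum_hyp0F1 (show 0 < α + 1 by linarith) _ using 2 with n
  rw [coe_fockBasis, ← inner_conj_symm, inner_fock_preCoherent, inner_fock_preCoherent, map_div₀,
    map_pow, Complex.conj_ofReal, div_mul_div_comm, ← Complex.ofReal_mul, ← sq, genFactorial_sq hα,
    ← mul_pow, div_pow, div_div]
  push_cast
  rfl

lemma norm_preCoherent_sq {α : ℝ} (hα : -1 < α) (z : ℂ) :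
    ‖preCoherent hα z‖ ^ 2 = normSq α z := by
  have h := inner_preCoherent hα z z
  rw [inner_self_eq_norm_sq_to_K, Complex.conj_mul', ← Complex.ofReal_pow] at h
  have h2 := ofReal_normSq hα z
  push_cast at h2 h
  rw [← h2] at h
  exact Complex.ofReal_injective (by rw [Complex.ofReal_pow]; exact h)

lemma norm_coherent {α : ℝ} (hα : -1 < α) (z : ℂ) : ‖coherent hα z‖ = 1 := by
  have h := normSq_pos hα z
  rw [coherent, norm_smul, Complex.norm_real, Real.norm_of_nonneg (by positivity),
    ← norm_preCoherent_sq hα, Real.sqrt_sq (norm_nonneg _), inv_mul_cancel₀]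
  intro h0
  rw [← norm_preCoherent_sq hα, h0] at h
  simp at h

lemma normSq_zero (α : ℝ) : normSq α 0 = 1 := by
  rw [normSq, tsum_eq_single 0]
  · simp [normSqTerm]
  · intro n hn
    simp [normSqTerm, hn]

lemma coherent_zero {α : ℝ} (hα : -1 < α) : coherent hα 0 = fock hα 0 := by
  rw [coherent, normSq_zero α, preCoherent, tsum_eq_single 0]
  · simp [coherentTerm, genFactorial]
  · intro n hn
    simp [coherentTerm, hn]

lemma inner_fock_coherent {α : ℝ} (hα : -1 < α) (n : ℕ) (z : ℂ) :
    inner ℂ (fock hα n) (coherent hα z) =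
      (((√(normSq α z))⁻¹ : ℝ) : ℂ) * (z ^ n / (genFactorial α n : ℂ)) := by
  rw [coherent, inner_smul_right, inner_fock_preCoherent]

lemma inner_coherent_zero {α : ℝ} (hα : -1 < α) (z : ℂ) :
    inner ℂ (coherent hα 0) (coherent hα z) = (((√(normSq α z))⁻¹ : ℝ) : ℂ) := by
  rw [coherent_zero, inner_fock_coherent]
  simp [genFactorial]

/-! ### Bessel functions and the overlap of coherent states -/

lemma besselI_eq {α : ℝ} (hα : -1 < α) (w : ℂ) :
    besselI α w = (w / 2) ^ (α : ℂ) / (Real.Gamma (α + 1) : ℂ) * hyp0F1 (α + 1) ((w / 2) ^ 2) := by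
  rw [besselI, div_mul_eq_mul_div, mul_div_assoc, hyp0F1, ← tsum_div_const]
  congr 1
  refine tsum_congr fun n => ?_
  rw [show α + n + 1 = α + 1 + n by ring, Gamma_add_natCast (by linarith), pow_mul, div_div]
  push_cast
  ring

lemma besselIReal_eq {α : ℝ} (hα : -1 < α) {z : ℂ} (hz : z ≠ 0) :
    besselIReal α (√2 * ‖z‖) = (‖z‖ / √2) ^ α / Real.Gamma (α + 1) * normSq α z := by
  have hx : √2 * ‖z‖ / 2 = ‖z‖ / √2 := by
    rw [div_eq_div_iff two_ne_zero (by positivity)]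
    linear_combination ‖z‖ * Real.mul_self_sqrt zero_le_two
  have hr : 0 < ‖z‖ := norm_pos_iff.2 hz
  have h := ofReal_besselIReal α (x := √2 * ‖z‖) (by positivity)
  rw [besselI_eq hα, show ((√2 * ‖z‖ : ℝ) : ℂ) / 2 = ((‖z‖ / √2 : ℝ) : ℂ) by
    rw [← hx]; push_cast; rfl, ← Complex.ofReal_cpow (by positivity), ← Complex.ofReal_pow, div_pow,
    Real.sq_sqrt zero_le_two, ← ofReal_normSq hα] at h
  exact_mod_cast h

lemma besselIReal_pos {α : ℝ} (hα : -1 < α) {z : ℂ} (hz : z ≠ 0) :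
    0 < besselIReal α (√2 * ‖z‖) := by
  have hG := Real.Gamma_pos_of_pos (show 0 < α + 1 by linarith)
  have := normSq_pos hα z
  have hr : 0 < ‖z‖ := norm_pos_iff.2 hz
  rw [besselIReal_eq hα hz]
  positivity

lemma normSq_eq_besselIReal {α : ℝ} (hα : -1 < α) {z : ℂ} (hz : z ≠ 0) :
    normSq α z = (√2 / ‖z‖) ^ α * Real.Gamma (α + 1) * besselIReal α (√2 * ‖z‖) := by
  have hG := Real.Gamma_pos_of_pos (show 0 < α + 1 by linarith)
  have hr : 0 < ‖z‖ := norm_pos_iff.2 hz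
  have h1 : (√2 / ‖z‖) ^ α * (‖z‖ / √2) ^ α = 1 := by
    rw [← Real.mul_rpow (by positivity) (by positivity), div_mul_div_cancel₀ hr.ne',
      div_self (by positivity), Real.one_rpow]
  rw [besselIReal_eq hα hz]
  field_simp
  linear_combination -normSq α z * h1

/-- The phase factor turns the branch of `(a √ζ)^α` into its modulus. -/
lemma cpow_div_norm_mul_cpow_sqrt (α : ℝ) {a : ℝ} (ha : 0 < a) {ζ : ℂ} (hζ : ζ ≠ 0) :
    (ζ / (‖ζ‖ : ℂ)) ^ (-(α : ℂ) / 2) * ((a : ℂ) * ζ ^ (1 / 2 : ℂ)) ^ (α : ℂ) =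
      ((a ^ α * ‖ζ‖ ^ (α / 2) : ℝ) : ℂ) := by
  have hr : 0 < ‖ζ‖ := norm_pos_iff.2 hζ
  have ha' : (a : ℂ) ≠ 0 := by exact_mod_cast ha.ne'
  have hr' : (‖ζ‖ : ℂ) ≠ 0 := by exact_mod_cast hr.ne'
  have hs : ζ ^ (1 / 2 : ℂ) ≠ 0 := by simp [Complex.cpow_eq_zero_iff, hζ]
  have hl1 : Complex.log (ζ / (‖ζ‖ : ℂ)) = Complex.log ζ - (Real.log ‖ζ‖ : ℂ) := by
    rw [div_eq_inv_mul, ← Complex.ofReal_inv, Complex.log_ofReal_mul (by positivity) hζ,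
      Real.log_inv]
    push_cast
    ring
  -- halving the argument keeps it in `(-π, π]`, so no multiple of `2πi` appears
  have hl2 : Complex.log (ζ ^ (1 / 2 : ℂ)) = Complex.log ζ / 2 := by
    have him : (Complex.log ζ * (1 / 2)).im = Complex.arg ζ / 2 := by
      rw [show (1 / 2 : ℂ) = ((1 / 2 : ℝ) : ℂ) by push_cast; rfl, Complex.im_mul_ofReal,
        Complex.log_im]
      ring
    have h1 := Complex.neg_pi_lt_arg ζ
    have h2 := Complex.arg_le_pi ζ
    have h3 := Real.pi_pos
    rw [Complex.cpow_def_of_ne_zero hζ, Complex.log_exp (by rw [him]; linarith)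
      (by rw [him]; linarith)]
    ring
  rw [Complex.ofReal_mul, Complex.ofReal_cpow ha.le, Complex.ofReal_cpow hr.le,
    Complex.cpow_def_of_ne_zero (div_ne_zero hζ hr'),
    Complex.cpow_def_of_ne_zero (mul_ne_zero ha' hs), Complex.cpow_def_of_ne_zero ha',
    Complex.cpow_def_of_ne_zero hr', ← Complex.exp_add, ← Complex.exp_add,
    hl1, Complex.log_ofReal_mul ha hs, hl2, Complex.ofReal_log ha.le, Complex.ofReal_log hr.le]
  congr 1
  push_cast
  ring

lemma cpow_half_sq (ζ : ℂ) : (ζ ^ (1 / 2 : ℂ)) ^ 2 = ζ := by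
  rw [one_div]
  exact Complex.cpow_nat_inv_pow ζ two_ne_zero

lemma inner_coherent {α : ℝ} (hα : -1 < α) {z₁ z₂ : ℂ} (h₁ : z₁ ≠ 0) (h₂ : z₂ ≠ 0) :
    inner ℂ (coherent hα z₁) (coherent hα z₂) =
      ((starRingEnd ℂ) z₁ * z₂ / ((‖z₁‖ * ‖z₂‖ : ℝ) : ℂ)) ^ (-(α : ℂ) / 2) *
        besselI α (((√2 : ℝ) : ℂ) * ((starRingEnd ℂ) z₁ * z₂) ^ (1 / 2 : ℂ)) /
        ((√(besselIReal α (√2 * ‖z₁‖) * besselIReal α (√2 * ‖z₂‖)) : ℝ) : ℂ) := by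
  have hG := Real.Gamma_pos_of_pos (show 0 < α + 1 by linarith)
  have hr₁ : 0 < ‖z₁‖ := norm_pos_iff.2 h₁
  have hr₂ : 0 < ‖z₂‖ := norm_pos_iff.2 h₂
  have hI₁ := besselIReal_pos hα h₁
  have hI₂ := besselIReal_pos hα h₂
  rw [coherent, coherent, inner_smul_left, inner_smul_right, Complex.conj_ofReal,
    inner_preCoherent, besselI_eq hα]
  set ζ := (starRingEnd ℂ) z₁ * z₂ with hζd
  have hζ : ζ ≠ 0 := mul_ne_zero (by simpa using h₁) h₂
  have hn : ‖ζ‖ = ‖z₁‖ * ‖z₂‖ := by rw [hζd, norm_mul, RCLike.norm_conj]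
  have hs2 : ((√2 : ℝ) : ℂ) ^ 2 = 2 := by
    rw [← Complex.ofReal_pow, Real.sq_sqrt zero_le_two]; norm_num
  have e1 : ((√2 : ℝ) : ℂ) * ζ ^ (1 / 2 : ℂ) / 2 = ((√2 / 2 : ℝ) : ℂ) * ζ ^ (1 / 2 : ℂ) := by
    push_cast; ring
  have e2 : (((√2 / 2 : ℝ) : ℂ) * ζ ^ (1 / 2 : ℂ)) ^ 2 = ζ / 2 := by
    rw [mul_pow, cpow_half_sq]
    push_cast
    rw [div_pow, hs2]
    ring
  have key := cpow_div_norm_mul_cpow_sqrt α (show 0 < √2 / 2 by positivity) hζ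
  rw [hn] at key
  rw [e1, e2]
  have hreal : (√(normSq α z₁))⁻¹ * (√(normSq α z₂))⁻¹ =
      (√2 / 2) ^ α * (‖z₁‖ * ‖z₂‖) ^ (α / 2) / Real.Gamma (α + 1) /
        √(besselIReal α (√2 * ‖z₁‖) * besselIReal α (√2 * ‖z₂‖)) := by
    rw [← mul_inv, ← Real.sqrt_mul (normSq_pos hα z₁).le, normSq_eq_besselIReal hα h₁,
      normSq_eq_besselIReal hα h₂, ← Real.sqrt_inv]
    refine (Real.sqrt_eq_iff_mul_self_eq (by positivity) (by positivity)).2 ?_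
    rw [div_mul_div_comm, Real.mul_self_sqrt (by positivity), div_mul_div_comm,
      mul_mul_mul_comm ((√2 / 2) ^ α), ← Real.rpow_add (by positivity : 0 < ‖z₁‖ * ‖z₂‖),
      add_halves,
      ← Real.mul_rpow (by positivity) (by positivity),
      show √2 / 2 * (√2 / 2) = 1 / 2 by
        linear_combination (1 / 4 : ℝ) * Real.mul_self_sqrt zero_le_two,
      ← Real.mul_rpow (by positivity) (by positivity),
      show (√2 / ‖z₁‖) ^ α * Real.Gamma (α + 1) * besselIReal α (√2 * ‖z₁‖) *
        ((√2 / ‖z₂‖) ^ α * Real.Gamma (α + 1) * besselIReal α (√2 * ‖z₂‖)) =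
        ((√2 / ‖z₁‖) ^ α * (√2 / ‖z₂‖) ^ α) * (Real.Gamma (α + 1) * Real.Gamma (α + 1)) *
        (besselIReal α (√2 * ‖z₁‖) * besselIReal α (√2 * ‖z₂‖)) by ring,
      ← Real.mul_rpow (by positivity) (by positivity), div_mul_div_comm,
      Real.mul_self_sqrt zero_le_two, mul_inv, mul_inv, ← Real.inv_rpow (by positivity), inv_div]
    rw [show 1 / 2 * (‖z₁‖ * ‖z₂‖) = ‖z₁‖ * ‖z₂‖ / 2 by ring]
    ring
  rw [← mul_assoc, ← Complex.ofReal_mul, hreal, Complex.ofReal_div, Complex.ofReal_div, ← key]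
  ring

/-! ### The closed form of the coherent states -/

/-- A series converging in `L²` and pointwise almost everywhere has the same sum in both senses. -/
lemma ae_eq_of_hasSum_of_hasSum_ae {X : Type*} [MeasurableSpace X] {μ : Measure X}
    {F : ℕ → Lp ℂ 2 μ} {f : Lp ℂ 2 μ} {g : X → ℂ} (hf : HasSum F f)
    (hg : ∀ᵐ x ∂μ, HasSum (fun n => F n x) (g x)) : f =ᵐ[μ] g := by
  -- `L²` convergence of the partial sums gives almost everywhere convergence of a subsequence
  have h1 := tendstoInMeasure_of_tendsto_Lp hf.tendsto_sum_nat
  obtain ⟨ns, hns, h2⟩ := h1.exists_seq_tendsto_ae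
  have h3 : ∀ᵐ x ∂μ, ∀ N, (∑ n ∈ Finset.range N, F n : Lp ℂ 2 μ) x =
      ∑ n ∈ Finset.range N, F n x := by
    rw [ae_all_iff]
    intro N
    exact Lp.coeFn_fun_finsetSum (Finset.range N) F
  filter_upwards [h2, h3, hg] with x hx2 hx3 hxg
  simp_rw [hx3] at hx2
  exact tendsto_nhds_unique hx2 (hxg.tendsto_sum_nat.comp hns.tendsto_atTop)

/-- The generating function of the Kummer polynomials: the series is the Cauchy product of the
exponential series and of `₀F₁`. -/
lemma hasSum_pow_div_factorial_mul_kummer {c : ℝ} (hc : 0 < c) (t : ℂ) (x : ℝ) :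
    HasSum (fun n : ℕ => t ^ n / (n.factorial : ℂ) * (kummer c n x : ℂ))
      (Complex.exp t * hyp0F1 c (-t * x)) := by
  have h1 := summable_norm_hyp0F1 hc (-t * x)
  have h2 : Summable fun k : ℕ => ‖t ^ k / (k.factorial : ℂ)‖ :=
    NormedSpace.norm_expSeries_div_summable t
  have h3 := tsum_mul_tsum_eq_tsum_sum_antidiagonal_of_summable_norm h1 h2
  have h4 := (summable_norm_sum_mul_antidiagonal_of_summable_norm h1 h2).of_norm.hasSum
  rw [← h3] at h4
  have e : ∑' k : ℕ, t ^ k / (k.factorial : ℂ) = Complex.exp t := by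
    rw [Complex.exp_eq_exp_ℂ, NormedSpace.exp_eq_tsum_div]
  rw [e, mul_comm (tsum _)] at h4
  convert! h4 using 2 with n
  rw [Finset.Nat.sum_antidiagonal_eq_sum_range_succ_mk, kummer, Complex.ofReal_sum, Finset.mul_sum]
  refine Finset.sum_congr rfl fun k hk => ?_
  have hk : k ≤ n := by simpa [Nat.lt_succ_iff] using hk
  have hp : (risingFactorial c k : ℂ) ≠ 0 := by exact_mod_cast (risingFactorial_pos hc k).ne'
  have hf1 : (k.factorial : ℂ) ≠ 0 := by exact_mod_cast k.factorial_ne_zero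
  have hf2 : ((n - k).factorial : ℂ) ≠ 0 := by exact_mod_cast (n - k).factorial_ne_zero
  have hch : (n.factorial : ℂ) = n.choose k * k.factorial * (n - k).factorial := by
    exact_mod_cast (Nat.choose_mul_factorial_mul_factorial hk).symm
  have hcf : (n.choose k : ℂ) ≠ 0 := by exact_mod_cast (Nat.choose_pos hk).ne'
  have ht : t ^ n = t ^ k * t ^ (n - k) := by rw [← pow_add, Nat.add_sub_cancel' hk]
  push_cast
  rw [ht, hch, mul_pow, neg_pow t]
  field_simp

lemma preCoherent_ae_eq {α : ℝ} (hα : -1 < α) (z : ℂ) :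
    (preCoherent hα z : ℝ → ℂ) =ᵐ[laguerreMeasure α] fun x =>
      Complex.exp (-z / ((√2 : ℝ) : ℂ)) * hyp0F1 (α + 1) (x * z / ((√2 : ℝ) : ℂ)) := by
  refine ae_eq_of_hasSum_of_hasSum_ae (hasSum_coherentTerm hα z) ?_
  have h : ∀ᵐ x ∂laguerreMeasure α, ∀ n, coherentTerm hα z n x =
      z ^ n / (genFactorial α n : ℂ) * (laguerrePsi α n x : ℂ) := by
    rw [ae_all_iff]
    intro n
    filter_upwards [coeFn_fock hα n, Lp.coeFn_smul (z ^ n / (genFactorial α n : ℂ)) (fock hα n)]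
      with x h1 h2
    rw [coherentTerm, h2, Pi.smul_apply, h1, smul_eq_mul]
  filter_upwards [h] with x hx
  simp_rw [hx]
  have h0 : ((√2 : ℝ) : ℂ) ≠ 0 := by
    have : (√2 : ℝ) ≠ 0 := by positivity
    exact_mod_cast this
  have hg := hasSum_pow_div_factorial_mul_kummer (show 0 < α + 1 by linarith)
    (-z / ((√2 : ℝ) : ℂ)) x
  rw [show -(-z / ((√2 : ℝ) : ℂ)) * (x : ℂ) = x * z / ((√2 : ℝ) : ℂ) by ring] at hg
  convert! hg using 2 with n
  have hp := risingFactorial_pos (show 0 < α + 1 by linarith) n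
  have hs : ((√(risingFactorial (α + 1) n / n.factorial) : ℝ) : ℂ) ≠ 0 := by
    have : √(risingFactorial (α + 1) n / n.factorial) ≠ 0 := by positivity
    exact_mod_cast this
  have hf : (n.factorial : ℂ) ≠ 0 := by exact_mod_cast n.factorial_ne_zero
  rw [genFactorial_eq hα, laguerrePsi_eq hα, neg_div, ← div_neg, div_pow]
  push_cast
  field_simp

lemma coherent_ae_eq {α : ℝ} (hα : -1 < α) {z : ℂ} (hz : z ≠ 0) :
    (coherent hα z : ℝ → ℂ) =ᵐ[laguerreMeasure α] fun x : ℝ =>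
      ((√(Real.Gamma (α + 1) / (x ^ α * besselIReal α (√2 * ‖z‖))) : ℝ) : ℂ) *
        (z / (‖z‖ : ℂ)) ^ (-(α : ℂ) / 2) * Complex.exp (-z / ((√2 : ℝ) : ℂ)) *
        besselI α ((((2 : ℝ) ^ (3 / 4 : ℝ) : ℝ) : ℂ) * ((x : ℂ) * z) ^ (1 / 2 : ℂ)) := by
  have hG := Real.Gamma_pos_of_pos (show 0 < α + 1 by linarith)
  have hr : 0 < ‖z‖ := norm_pos_iff.2 hz
  have hI := besselIReal_pos hα hz
  have hpos : ∀ᵐ x ∂laguerreMeasure α, 0 < x :=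
    withDensity_absolutelyContinuous _ _ (ae_restrict_mem measurableSet_Ioi)
  filter_upwards [hpos, preCoherent_ae_eq hα z,
    Lp.coeFn_smul (((√(normSq α z))⁻¹ : ℝ) : ℂ) (preCoherent hα z)] with x hx h1 h2
  have hxz : (x : ℂ) * z ≠ 0 := mul_ne_zero (by exact_mod_cast hx.ne') hz
  have hn : ‖(x : ℂ) * z‖ = x * ‖z‖ := by
    rw [norm_mul, Complex.norm_real, Real.norm_of_nonneg hx.le]
  set a : ℝ := (2 : ℝ) ^ (3 / 4 : ℝ) / 2 with ha
  have ha0 : 0 < a := by positivity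
  have ha2 : a ^ 2 = 1 / √2 := by
    rw [ha, div_pow, ← Real.rpow_natCast, ← Real.rpow_mul zero_le_two,
      show (3 / 4 : ℝ) * (2 : ℕ) = 1 + 1 / 2 by norm_num, Real.rpow_add two_pos, Real.rpow_one,
      ← Real.sqrt_eq_rpow, div_eq_div_iff (by positivity) (by positivity)]
    linear_combination 2 * Real.mul_self_sqrt zero_le_two
  -- `z` and `x z` have the same phase, as `x > 0`
  have key := cpow_div_norm_mul_cpow_sqrt α ha0 hxz
  have hdiv : (x : ℂ) * z / ((‖(x : ℂ) * z‖ : ℝ) : ℂ) = z / (‖z‖ : ℂ) := by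
    rw [hn, Complex.ofReal_mul, mul_div_mul_left _ _ (by exact_mod_cast hx.ne')]
  rw [hdiv, hn] at key
  have e1 : (((2 : ℝ) ^ (3 / 4 : ℝ) : ℝ) : ℂ) * ((x : ℂ) * z) ^ (1 / 2 : ℂ) / 2 =
      (a : ℂ) * ((x : ℂ) * z) ^ (1 / 2 : ℂ) := by
    rw [ha]; push_cast; ring
  have e2 : ((a : ℂ) * ((x : ℂ) * z) ^ (1 / 2 : ℂ)) ^ 2 = x * z / ((√2 : ℝ) : ℂ) := by
    rw [mul_pow, cpow_half_sq, ← Complex.ofReal_pow, ha2]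
    push_cast
    ring
  have hreal : (√(normSq α z))⁻¹ = √(Real.Gamma (α + 1) / (x ^ α * besselIReal α (√2 * ‖z‖))) *
      (a ^ α * (x * ‖z‖) ^ (α / 2) / Real.Gamma (α + 1)) := by
    rw [normSq_eq_besselIReal hα hz, ← Real.sqrt_inv]
    refine (Real.sqrt_eq_iff_mul_self_eq (by positivity) (by positivity)).2 ?_
    rw [mul_mul_mul_comm, Real.mul_self_sqrt (by positivity), div_mul_div_comm, mul_mul_mul_comm,
      ← Real.rpow_add (by positivity : 0 < x * ‖z‖), add_halves,
      ← Real.mul_rpow (by positivity) (by positivity), ← sq, ha2, mul_inv, mul_inv,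
      ← Real.inv_rpow (by positivity), inv_div, Real.mul_rpow hx.le hr.le,
      Real.div_rpow (by positivity) (by positivity), Real.div_rpow (by positivity) (by positivity),
      Real.one_rpow]
    field_simp
  rw [coherent, h2, Pi.smul_apply, h1, smul_eq_mul, besselI_eq hα, e1, e2, hreal]
  rw [Complex.ofReal_mul, Complex.ofReal_div _ (Real.Gamma (α + 1)), ← key]
  ring

/-! ### Moments of the Macdonald function -/

lemma integrable_exp_neg_mul_cosh_add (α : ℝ) {s : ℝ} (hs : 0 < s) :
    Integrable fun t : ℝ => Real.exp (-s * Real.cosh t + α * t) := by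
  have hg : Integrable fun t : ℝ => Real.exp (-(s / 4) * t ^ 2 + α * t) := by
    have h := (integrable_cexp_quadratic (b := ((s / 4 : ℝ) : ℂ))
      (by rw [Complex.ofReal_re]; positivity) (α : ℂ) 0).norm
    refine h.congr (.of_forall fun t => ?_)
    have e : -((s / 4 : ℝ) : ℂ) * (t : ℂ) ^ 2 + (α : ℂ) * (t : ℂ) + 0 =
        ((-(s / 4) * t ^ 2 + α * t : ℝ) : ℂ) := by
      push_cast; ring
    simp only
    rw [e, Complex.norm_exp, Complex.ofReal_re]
  refine hg.mono' (by fun_prop) (.of_forall fun t => ?_)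
  rw [Real.norm_of_nonneg (Real.exp_pos _).le]
  gcongr Real.exp (?_ + _)
  have h1 := Real.quadratic_le_exp_of_nonneg (abs_nonneg t)
  have h2 : Real.exp |t| / 2 ≤ Real.cosh t := by
    rw [← Real.cosh_abs, Real.cosh_eq]
    have := Real.exp_pos (-|t|)
    linarith
  have h3 : t ^ 2 / 4 ≤ Real.cosh t := by
    rw [sq_abs] at h1
    have := abs_nonneg t
    linarith
  nlinarith

lemma besselK_eq_integral_univ (α : ℝ) {s : ℝ} (hs : 0 < s) :
    besselK α s = 1 / 2 * ∫ t : ℝ, Real.exp (-s * Real.cosh t + α * t) := by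
  have h1 := integral_comp_abs (f := fun t => Real.exp (-s * Real.cosh t) * Real.cosh (α * t))
  have e (t : ℝ) : Real.exp (-s * Real.cosh |t|) * Real.cosh (α * |t|) =
      1 / 2 * Real.exp (-s * Real.cosh t + α * t) +
        1 / 2 * Real.exp (-s * Real.cosh (-t) + α * (-t)) := by
    have : Real.cosh (α * |t|) = Real.cosh (α * t) := by
      rw [← Real.cosh_abs, ← Real.cosh_abs (α * t), abs_mul, abs_mul, abs_abs]
    rw [this, Real.cosh_abs, Real.cosh_neg, Real.exp_add, Real.exp_add, Real.cosh_eq (α * t),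
      mul_neg]
    ring
  have hi := (integrable_exp_neg_mul_cosh_add α hs).const_mul (1 / 2)
  simp_rw [e] at h1
  rw [integral_add hi hi.comp_neg, integral_neg_eq_self
    (fun t => 1 / 2 * Real.exp (-s * Real.cosh t + α * t)), integral_const_mul] at h1
  rw [besselK]
  linarith

/-- The substitution `τ = (s / 2) eᵗ`, which turns `s cosh t` into `τ + s² / (4 τ)`. -/
lemma besselK_eq_integral_Ioi (α : ℝ) {s : ℝ} (hs : 0 < s) :
    besselK α s = 1 / 2 * ∫ τ in Set.Ioi (0 : ℝ),
      (2 * τ / s) ^ α * τ⁻¹ * Real.exp (-τ - s ^ 2 / (4 * τ)) := by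
  have himg : (fun t => s / 2 * Real.exp t) '' Set.univ = Set.Ioi 0 := by
    rw [Set.image_univ]
    ext τ
    constructor
    · rintro ⟨t, rfl⟩
      exact mul_pos (by positivity) (Real.exp_pos t)
    · intro hτ
      have hτ : 0 < τ := hτ
      refine ⟨Real.log (2 * τ / s), ?_⟩
      simp only
      rw [Real.exp_log (by positivity)]
      field_simp
  have hinj : Set.InjOn (fun t => s / 2 * Real.exp t) Set.univ := by
    intro a _ b _ hab
    exact Real.exp_injective (mul_left_cancel₀ (by positivity) hab)
  rw [besselK_eq_integral_univ α hs, ← himg, integral_image_eq_integral_abs_deriv_smul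
    (f' := fun t => s / 2 * Real.exp t) .univ
    (fun t _ => ((Real.hasDerivAt_exp t).const_mul _).hasDerivWithinAt) hinj,
    Measure.restrict_univ]
  congr 1
  refine integral_congr_ae (.of_forall fun t => ?_)
  have hp : 0 < s / 2 * Real.exp t := by positivity
  simp only [smul_eq_mul]
  rw [abs_of_pos hp, mul_comm (_ ^ α), ← mul_assoc, ← mul_assoc, mul_inv_cancel₀ hp.ne', one_mul,
    show 2 * (s / 2 * Real.exp t) / s = Real.exp t by field_simp, ← Real.exp_mul, ← Real.exp_add]
  congr 1
  rw [Real.cosh_eq, Real.exp_neg]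
  field_simp
  ring

/-- Fubini's theorem reduces the moments of `K_α` to a Gaussian integral and a Gamma integral. -/
lemma integral_rpow_mul_besselK {α : ℝ} (hα : -1 < α) (n : ℕ) :
    ∫ s in Set.Ioi (0 : ℝ), s ^ (2 * n + 1 + α) * besselK α s =
      (2 : ℝ) ^ (2 * n + α) * n.factorial * Real.Gamma (α + n + 1) := by
  -- the integrand in `(s, τ)`, arranged for the integration in `s` at fixed `τ`
  set G : ℝ × ℝ → ℝ := fun p =>
    (p.1 ^ (2 * n + 1 : ℝ) * Real.exp (-(1 / (4 * p.2)) * p.1 ^ (2 : ℝ))) *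
      (1 / 2 * 2 ^ α * (p.2 ^ (α - 1) * Real.exp (-p.2))) with hG
  have hGm : Measurable G := by
    rw [hG]; fun_prop
  have hn : (-1 : ℝ) < 2 * n + 1 := by
    have : (0 : ℝ) ≤ n := n.cast_nonneg
    linarith
  have inner_eq (τ : ℝ) (hτ : 0 < τ) : ∫ s in Set.Ioi (0 : ℝ), G (s, τ) =
      1 / 4 * 2 ^ α * 4 ^ (n + 1) * n.factorial * (τ ^ (α + n + 1 - 1) * Real.exp (-(1 * τ))) := by
    simp only [hG]
    rw [integral_mul_const, integral_rpow_mul_exp_neg_mul_rpow two_pos hn (by positivity),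
      show (2 * (n : ℝ) + 1 + 1) / 2 = n + 1 by ring, Real.Gamma_nat_eq_factorial, neg_div,
      show (2 * (n : ℝ) + 1 + 1) / 2 = ((n + 1 : ℕ) : ℝ) by push_cast; ring,
      Real.rpow_neg (by positivity), Real.rpow_natCast, one_div (4 * τ), inv_pow, inv_inv, mul_pow,
      show α + n + 1 - 1 = α - 1 + ((n + 1 : ℕ) : ℝ) by push_cast; ring, Real.rpow_add hτ,
      Real.rpow_natCast, one_mul]
    ring
  have hpos (s τ : ℝ) (hs : 0 < s) (hτ : 0 < τ) : 0 ≤ G (s, τ) := by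
    simp only [hG]; positivity
  have hn1 : 0 < α + n + 1 := by
    have : (0 : ℝ) ≤ n := n.cast_nonneg
    linarith
  have hprod : Integrable G ((volume.restrict (Set.Ioi 0)).prod (volume.restrict (Set.Ioi 0))) := by
    rw [integrable_prod_iff' hGm.aestronglyMeasurable]
    constructor
    · filter_upwards [ae_restrict_mem measurableSet_Ioi] with τ hτ
      have hτ : 0 < τ := hτ
      simp only [hG]
      exact (integrableOn_rpow_mul_exp_neg_mul_rpow (b := 1 / (4 * τ)) hn two_pos
        (by positivity)).mul_const _
    · have h : Integrable (fun τ : ℝ => 1 / 4 * 2 ^ α * 4 ^ (n + 1) * n.factorial *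
          (τ ^ (α + n + 1 - 1) * Real.exp (-(1 * τ)))) (volume.restrict (Set.Ioi 0)) := by
        refine Integrable.const_mul (Integrable.of_integral_ne_zero ?_) _
        rw [Real.integral_rpow_mul_exp_neg_mul_Ioi hn1 one_pos]
        have := Real.Gamma_pos_of_pos hn1
        positivity
      refine h.congr ?_
      filter_upwards [ae_restrict_mem measurableSet_Ioi] with τ hτ
      have hτ : 0 < τ := hτ
      rw [← inner_eq τ hτ]
      refine setIntegral_congr_fun measurableSet_Ioi fun s hs => ?_
      exact (Real.norm_of_nonneg (hpos s τ hs hτ)).symm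
  have hswap := integral_integral_swap (f := fun s τ => G (s, τ)) hprod
  have hL : ∫ s in Set.Ioi (0 : ℝ), ∫ τ in Set.Ioi (0 : ℝ), G (s, τ) =
      ∫ s in Set.Ioi (0 : ℝ), s ^ (2 * n + 1 + α) * besselK α s := by
    refine setIntegral_congr_fun measurableSet_Ioi fun s hs => ?_
    have hs : 0 < s := hs
    rw [besselK_eq_integral_Ioi α hs, ← mul_assoc, ← integral_const_mul]
    refine setIntegral_congr_fun measurableSet_Ioi fun τ hτ => ?_
    have hτ : 0 < τ := hτ
    simp only [hG]
    rw [Real.div_rpow (by positivity) hs.le, Real.mul_rpow two_pos.le hτ.le,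
      Real.rpow_add hs _ α, Real.rpow_sub_one hτ.ne', Real.rpow_two,
      show -τ - s ^ 2 / (4 * τ) = -(1 / (4 * τ)) * s ^ 2 + -τ by ring, Real.exp_add]
    have : s ^ α ≠ 0 := by positivity
    field_simp
  have hR : ∫ τ in Set.Ioi (0 : ℝ), ∫ s in Set.Ioi (0 : ℝ), G (s, τ) =
      1 / 4 * 2 ^ α * 4 ^ (n + 1) * n.factorial * Real.Gamma (α + n + 1) := by
    rw [setIntegral_congr_fun measurableSet_Ioi fun τ hτ => inner_eq τ hτ, integral_const_mul,
      Real.integral_rpow_mul_exp_neg_mul_Ioi hn1 one_pos]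
    simp
  rw [← hL, hswap, hR, Real.rpow_add two_pos, Real.rpow_mul two_pos.le, Real.rpow_two,
    Real.rpow_natCast]
  ring

lemma besselK_nonneg (α x : ℝ) : 0 ≤ besselK α x :=
  integral_nonneg fun _ => by have := Real.cosh_pos (α * ‹ℝ›); positivity

lemma measurable_besselK (α : ℝ) : Measurable (besselK α) := by
  have h : StronglyMeasurable fun p : ℝ × ℝ =>
      Real.exp (-p.1 * Real.cosh p.2) * Real.cosh (α * p.2) := by
    have : Measurable fun p : ℝ × ℝ =>
      Real.exp (-p.1 * Real.cosh p.2) * Real.cosh (α * p.2) := by fun_prop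
    exact this.stronglyMeasurable
  exact (h.integral_prod_right' (ν := volume.restrict (Set.Ioi 0))).measurable

/-! ### Resolution of the identity -/

lemma measurable_normSq {α : ℝ} (hα : -1 < α) : Measurable (normSq α) := by
  refine measurable_of_tendsto_metrizable
    (f := fun N z => ∑ n ∈ Finset.range N, normSqTerm α z n) (fun N => ?_) ?_
  · unfold normSqTerm
    fun_prop
  · rw [tendsto_pi_nhds]
    exact fun z => (summable_normSqTerm hα z).hasSum.tendsto_sum_nat

/-- The radial weight `(|z| / √2)^α K_α(√2 |z|) / (π Γ(α + 1))`, which is the density of `ν`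
divided by `𝒩²`. -/
noncomputable def radialWeight (α r : ℝ) : ℝ :=
  (r / √2) ^ α * besselK α (√2 * r) / (Real.pi * Real.Gamma (α + 1))

lemma integral_pow_mul_radialWeight {α : ℝ} (hα : -1 < α) (n : ℕ) :
    ∫ r in Set.Ioi (0 : ℝ), r ^ (2 * n + 1) * radialWeight α r =
      genFactorial α n ^ 2 / (2 * Real.pi) := by
  have hG := Real.Gamma_pos_of_pos (show 0 < α + 1 by linarith)
  have h := integral_comp_mul_left_Ioi (fun s => s ^ (2 * n + 1 + α) * besselK α s) 0
    (show 0 < √2 by positivity)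
  rw [mul_zero, integral_rpow_mul_besselK hα, smul_eq_mul] at h
  have e : ∀ r ∈ Set.Ioi (0 : ℝ), r ^ (2 * n + 1) * radialWeight α r =
      (√2 ^ (2 * n + 1) * (2 : ℝ) ^ α * (Real.pi * Real.Gamma (α + 1)))⁻¹ *
      ((√2 * r) ^ (2 * n + 1 + α) * besselK α (√2 * r)) := by
    intro r hr
    have hr : 0 < r := hr
    have h2 : (2 : ℝ) ^ α = √2 ^ α * √2 ^ α := by
      rw [← Real.mul_rpow (by positivity) (by positivity), Real.mul_self_sqrt zero_le_two]
    have h3 : (√2 * r) ^ (2 * n + 1 + α) =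
        √2 ^ (2 * n + 1) * r ^ (2 * n + 1) * (√2 ^ α * r ^ α) := by
      rw [Real.rpow_add (by positivity), Real.mul_rpow (by positivity) hr.le (z := α), ← mul_pow,
        ← Real.rpow_natCast]
      push_cast
      rfl
    have h4 : (0 : ℝ) < √2 ^ α := by positivity
    have h5 := Real.pi_pos
    rw [h2, h3, radialWeight, Real.div_rpow hr.le (by positivity)]
    field_simp
  rw [setIntegral_congr_fun measurableSet_Ioi e, integral_const_mul, h, genFactorial_sq hα,
    show α + n + 1 = α + 1 + n by ring, Gamma_add_natCast (by linarith), Real.rpow_add two_pos,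
    Real.rpow_mul two_pos.le, Real.rpow_two, Real.rpow_natCast]
  have h4 : (0 : ℝ) < 2 ^ α := by positivity
  have h5 := Real.pi_pos
  have h6 : √2 ^ (2 * n + 1) * √2 = 2 ^ (n + 1) := by
    rw [← pow_succ, show 2 * n + 1 + 1 = 2 * (n + 1) by ring, pow_mul, Real.sq_sqrt zero_le_two]
  have h7 : ((2 : ℝ) ^ 2) ^ n = 2 ^ n * 2 ^ n := by rw [← mul_pow]; norm_num
  rw [h7]
  field_simp
  linear_combination (-(risingFactorial (α + 1) n)) * h6

lemma integral_exp_int_mul_I {k : ℤ} :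
    ∫ θ in Set.Ioo (-Real.pi) Real.pi, Complex.exp ((k : ℂ) * Complex.I * θ) =
      if k = 0 then 2 * (Real.pi : ℂ) else 0 := by
  have hp := Real.pi_pos
  rw [← integral_Ioc_eq_integral_Ioo, ← intervalIntegral.integral_of_le (by linarith)]
  split_ifs with hk
  · subst hk
    simp
    ring
  · have hk' : (k : ℂ) * Complex.I ≠ 0 := mul_ne_zero (by exact_mod_cast hk) Complex.I_ne_zero
    rw [integral_exp_mul_complex hk', div_eq_zero_iff]
    left
    have : (k : ℂ) * Complex.I * (Real.pi : ℂ) =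
        (k : ℂ) * Complex.I * ((-Real.pi : ℝ) : ℂ) + k * (2 * Real.pi * Complex.I) := by
      push_cast; ring
    rw [this, Complex.exp_periodic.int_mul k, sub_self]

/-- In polar coordinates, the angular integral makes the monomials orthogonal for every radial
weight. -/
lemma integral_pow_mul_conj_pow_mul_radialWeight {α : ℝ} (hα : -1 < α) (m n : ℕ) :
    ∫ z : ℂ, z ^ m * (starRingEnd ℂ) z ^ n * (radialWeight α ‖z‖ : ℂ) =
      if m = n then ((genFactorial α n ^ 2 : ℝ) : ℂ) else 0 := by
  rw [← Complex.integral_comp_polarCoord_symm]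
  have e : ∀ p ∈ polarCoord.target, p.1 • ((Complex.polarCoord.symm p) ^ m *
      (starRingEnd ℂ) (Complex.polarCoord.symm p) ^ n *
        (radialWeight α ‖Complex.polarCoord.symm p‖ : ℂ)) =
      ((p.1 ^ (m + n + 1) * radialWeight α p.1 : ℝ) : ℂ) *
        Complex.exp (((m - n : ℤ) : ℂ) * Complex.I * p.2) := by
    intro p hp
    have hr : 0 < p.1 := hp.1
    have hz : Complex.polarCoord.symm p = p.1 * Complex.exp (p.2 * Complex.I) := by
      rw [Complex.polarCoord_symm_apply, Complex.exp_mul_I, Complex.ofReal_cos, Complex.ofReal_sin]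
    have hc : (starRingEnd ℂ) (Complex.exp (p.2 * Complex.I)) =
        Complex.exp (-(p.2 * Complex.I)) := by
      rw [← Complex.exp_conj, map_mul, Complex.conj_ofReal, Complex.conj_I, mul_neg]
    rw [Complex.norm_polarCoord_symm, abs_of_pos hr, hz, map_mul, Complex.conj_ofReal, hc, mul_pow,
      mul_pow, ← Complex.exp_nat_mul, ← Complex.exp_nat_mul, Complex.real_smul,
      show ((m - n : ℤ) : ℂ) * Complex.I * p.2 =
        m * (p.2 * Complex.I) + n * (-(p.2 * Complex.I)) by push_cast; ring, Complex.exp_add]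
    push_cast
    ring
  rw [setIntegral_congr_fun polarCoord.open_target.measurableSet e, polarCoord_target,
    Measure.volume_eq_prod, setIntegral_prod_mul
      (fun r : ℝ => ((r ^ (m + n + 1) * radialWeight α r : ℝ) : ℂ))
      (fun θ : ℝ => Complex.exp (((m - n : ℤ) : ℂ) * Complex.I * θ)),
    integral_exp_int_mul_I]
  by_cases h : m = n
  · subst h
    rw [integral_complex_ofReal, ← two_mul, integral_pow_mul_radialWeight hα]
    simp
  · have : ((m : ℤ) - n) ≠ 0 := by omega
    simp [h, this]

lemma density_eq_normSq_mul_radialWeight {α : ℝ} (hα : -1 < α) {z : ℂ} (hz : z ≠ 0) :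
    1 / Real.pi * besselK α (√2 * ‖z‖) * besselIReal α (√2 * ‖z‖) =
      normSq α z * radialWeight α ‖z‖ := by
  have hG := Real.Gamma_pos_of_pos (show 0 < α + 1 by linarith)
  have h5 := Real.pi_pos
  rw [besselIReal_eq hα hz, radialWeight]
  field_simp

lemma measurable_radialWeight (α : ℝ) : Measurable (radialWeight α) := by
  have := measurable_besselK α
  unfold radialWeight
  fun_prop

lemma radialWeight_nonneg {α : ℝ} (hα : -1 < α) {r : ℝ} (hr : 0 ≤ r) : 0 ≤ radialWeight α r := by
  have hG := Real.Gamma_pos_of_pos (show 0 < α + 1 by linarith)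
  have h5 := Real.pi_pos
  have := besselK_nonneg α (√2 * r)
  unfold radialWeight
  positivity

lemma coherentMeasure_eq {α : ℝ} (hα : -1 < α) :
    coherentMeasure α =
      volume.withDensity fun z => ENNReal.ofReal (normSq α z * radialWeight α ‖z‖) := by
  refine withDensity_congr_ae ?_
  filter_upwards [compl_mem_ae_iff.2 (measure_singleton (0 : ℂ))] with z hz
  rw [density_eq_normSq_mul_radialWeight hα hz]

lemma integral_coherentMeasure {α : ℝ} (hα : -1 < α) (f : ℂ → ℂ) :
    ∫ z, f z ∂coherentMeasure α = ∫ z, (normSq α z * radialWeight α ‖z‖ : ℝ) • f z := by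
  have h1 := measurable_normSq hα
  have h2 := measurable_radialWeight α
  rw [coherentMeasure_eq hα, integral_withDensity_eq_integral_toReal_smul (by fun_prop) (by simp)]
  refine integral_congr_ae (.of_forall fun z => ?_)
  simp only
  rw [ENNReal.toReal_ofReal (mul_nonneg (normSq_pos hα z).le
    (radialWeight_nonneg hα (norm_nonneg z)))]

/-- The function `z ↦ ⟨z; α|n⟩`. -/
noncomputable def transformFock {α : ℝ} (hα : -1 < α) (n : ℕ) (z : ℂ) : ℂ :=
  inner ℂ (coherent hα z) (fock hα n)

lemma transformFock_eq {α : ℝ} (hα : -1 < α) (n : ℕ) (z : ℂ) :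
    transformFock hα n z = (((√(normSq α z))⁻¹ : ℝ) : ℂ) *
      ((starRingEnd ℂ) z ^ n / (genFactorial α n : ℂ)) := by
  rw [transformFock, ← inner_conj_symm, inner_fock_coherent, map_mul, map_div₀, map_pow,
    Complex.conj_ofReal, Complex.conj_ofReal]

lemma measurable_transformFock {α : ℝ} (hα : -1 < α) (n : ℕ) : Measurable (transformFock hα n) := by
  have h1 := measurable_normSq hα
  have e : transformFock hα n = fun z => (((√(normSq α z))⁻¹ : ℝ) : ℂ) *
      ((starRingEnd ℂ) z ^ n / (genFactorial α n : ℂ)) := funext (transformFock_eq hα n)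
  rw [e]
  have hc : Measurable (starRingEnd ℂ : ℂ → ℂ) := Complex.continuous_conj.measurable
  fun_prop

lemma integral_transformFock {α : ℝ} (hα : -1 < α) (m n : ℕ) :
    ∫ z, (starRingEnd ℂ) (transformFock hα m z) * transformFock hα n z ∂coherentMeasure α =
      if m = n then 1 else 0 := by
  rw [integral_coherentMeasure hα]
  have e (z : ℂ) : (normSq α z * radialWeight α ‖z‖ : ℝ) •
      ((starRingEnd ℂ) (transformFock hα m z) * transformFock hα n z) =
      ((genFactorial α m : ℂ) * (genFactorial α n : ℂ))⁻¹ *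
        (z ^ m * (starRingEnd ℂ) z ^ n * (radialWeight α ‖z‖ : ℂ)) := by
    have hN := normSq_pos hα z
    have h1 : ((normSq α z : ℝ) : ℂ) = (√(normSq α z) : ℂ) * (√(normSq α z) : ℂ) := by
      rw [← Complex.ofReal_mul, Real.mul_self_sqrt hN.le]
    have h2 : (√(normSq α z) : ℂ) ≠ 0 := by exact_mod_cast (Real.sqrt_pos.2 hN).ne'
    rw [transformFock_eq, transformFock_eq, map_mul, map_div₀, map_pow, Complex.conj_ofReal,
      Complex.conj_ofReal, Complex.conj_conj, Complex.real_smul, Complex.ofReal_mul, h1,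
      Complex.ofReal_inv]
    field_simp
  simp_rw [e]
  rw [integral_const_mul, integral_pow_mul_conj_pow_mul_radialWeight hα]
  split_ifs with h
  · subst h
    have := genFactorial_ne_zero hα m
    have : (genFactorial α m : ℂ) ≠ 0 := by exact_mod_cast this
    push_cast
    field_simp
  · simp

lemma memLp_transformFock {α : ℝ} (hα : -1 < α) (n : ℕ) :
    MemLp (transformFock hα n) 2 (coherentMeasure α) := by
  rw [memLp_two_iff_integrable_sq_norm (measurable_transformFock hα n).aestronglyMeasurable]
  -- the integral is `1`, so the integrand is integrable
  have h : Integrable (fun z => (starRingEnd ℂ) (transformFock hα n z) * transformFock hα n z)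
      (coherentMeasure α) := .of_integral_ne_zero (by rw [integral_transformFock]; simp)
  refine h.re.congr (.of_forall fun z => ?_)
  simp only
  rw [Complex.conj_mul', ← Complex.ofReal_pow]
  exact Complex.ofReal_re _

lemma orthonormal_transformFock {α : ℝ} (hα : -1 < α) :
    Orthonormal ℂ fun n => (memLp_transformFock hα n).toLp (transformFock hα n) := by
  rw [orthonormal_iff_ite]
  intro m n
  rw [L2.inner_def, ← integral_transformFock hα m n]
  refine integral_congr_ae ?_
  filter_upwards [(memLp_transformFock hα m).coeFn_toLp, (memLp_transformFock hα n).coeFn_toLp]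
    with z h1 h2
  rw [h1, h2, RCLike.inner_apply, mul_comm]

/-- The coherent-state transform, sending the basis vector `|n⟩` to the function `z ↦ ⟨z; α|n⟩`. -/
noncomputable def coherentTransform {α : ℝ} (hα : -1 < α) :
    FockSpace α →ₗᵢ[ℂ] Lp ℂ 2 (coherentMeasure α) :=
  (orthonormal_transformFock hα).orthogonalFamily.linearIsometry.comp
    (fockBasis hα).repr.toLinearIsometry

/-- The isometry defined on basis vectors is given by `f ↦ ⟨z; α|f⟩` on the whole space, since the
expansion of `⟨z; α|f⟩` in the basis converges for every `z`. -/
lemma coherentTransform_ae_eq {α : ℝ} (hα : -1 < α) (f : FockSpace α) :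
    (coherentTransform hα f : ℂ → ℂ) =ᵐ[coherentMeasure α]
      fun z => inner ℂ (coherent hα z) f := by
  refine ae_eq_of_hasSum_of_hasSum_ae
    ((orthonormal_transformFock hα).orthogonalFamily.hasSum_linearIsometry _) ?_
  have h : ∀ᵐ z ∂coherentMeasure α, ∀ n,
      ((fockBasis hα).repr f n • (memLp_transformFock hα n).toLp (transformFock hα n) :
        Lp ℂ 2 (coherentMeasure α)) z = (fockBasis hα).repr f n * transformFock hα n z := by
    rw [ae_all_iff]
    intro n
    filter_upwards [(memLp_transformFock hα n).coeFn_toLp, Lp.coeFn_smul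
      ((fockBasis hα).repr f n) ((memLp_transformFock hα n).toLp (transformFock hα n))] with z h1 h2
    rw [h2, Pi.smul_apply, h1, smul_eq_mul]
  filter_upwards [h] with z hz
  have hs := (fockBasis hα).hasSum_inner_mul_inner (coherent hα z) f
  convert! hs using 2 with n
  refine (hz n).trans ?_
  rw [HilbertBasis.repr_apply_apply, coe_fockBasis, transformFock, mul_comm]

lemma resolution_of_identity {α : ℝ} (hα : -1 < α) (f g : FockSpace α) :
    Integrable (fun z : ℂ => inner ℂ f (coherent hα z) * inner ℂ (coherent hα z) g)
        (coherentMeasure α) ∧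
      ∫ z : ℂ, inner ℂ f (coherent hα z) * inner ℂ (coherent hα z) g ∂coherentMeasure α =
        inner ℂ f g := by
  have h : (fun z => inner ℂ (coherentTransform hα f z) (coherentTransform hα g z))
      =ᵐ[coherentMeasure α]
      fun z => inner ℂ f (coherent hα z) * inner ℂ (coherent hα z) g := by
    filter_upwards [coherentTransform_ae_eq hα f, coherentTransform_ae_eq hα g] with z h1 h2
    rw [h1, h2, RCLike.inner_apply, inner_conj_symm, mul_comm]
  refine ⟨(L2.integrable_inner _ _).congr h, ?_⟩
  rw [← integral_congr_ae h, ← L2.inner_def, LinearIsometry.inner_map_map]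

end LaguerreOscillator

theorem mainTheorem2 (α : ℝ) (hα : -1 < α) :
    -- the Laguerre system is orthonormal for the probability measure `μ_α`,
    -- and `aₙ`, `bₙ` are its recurrence coefficients
    (MeasureTheory.IsProbabilityMeasure (LaguerreOscillator.laguerreMeasure α) ∧
      Orthonormal ℂ (LaguerreOscillator.fock hα) ∧
      ∀ (n : ℕ) (x : ℝ),
        x * LaguerreOscillator.laguerrePsi α n x =
          LaguerreOscillator.coeffB α n * LaguerreOscillator.laguerrePsi α (n + 1) x +
          LaguerreOscillator.coeffA α n * LaguerreOscillator.laguerrePsi α n x +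
          (if n = 0 then 0 else
            LaguerreOscillator.coeffB α (n - 1) * LaguerreOscillator.laguerrePsi α (n - 1) x)) ∧
    -- the defining series converge, `𝒩²` is the squared norm, and the states are normalized
    (∀ z : ℂ,
      Summable (LaguerreOscillator.normSqTerm α z) ∧
      Summable (LaguerreOscillator.coherentTerm hα z) ∧
      ‖LaguerreOscillator.preCoherent hα z‖ ^ 2 = LaguerreOscillator.normSq α z ∧
      ‖LaguerreOscillator.coherent hα z‖ = 1) ∧
    -- the normalizing factor
    (∀ z : ℂ, z ≠ 0 →
      LaguerreOscillator.normSq α z =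
        (√2 / ‖z‖) ^ α * Real.Gamma (α + 1) *
          LaguerreOscillator.besselIReal α (√2 * ‖z‖)) ∧
    -- closed form of the states
    (∀ z : ℂ, z ≠ 0 →
      (LaguerreOscillator.coherent hα z : ℝ → ℂ)
        =ᵐ[LaguerreOscillator.laguerreMeasure α] fun x : ℝ =>
          ((√(Real.Gamma (α + 1) /
              (x ^ α * LaguerreOscillator.besselIReal α (√2 * ‖z‖))) : ℝ) : ℂ) *
            (z / (‖z‖ : ℂ)) ^ (-(α : ℂ) / 2) *
            Complex.exp (-z / ((√2 : ℝ) : ℂ)) *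
            LaguerreOscillator.besselI α
              ((((2 : ℝ) ^ (3 / 4 : ℝ) : ℝ) : ℂ) * ((x : ℂ) * z) ^ (1 / 2 : ℂ))) ∧
    -- the overlap
    (∀ z₁ z₂ : ℂ, z₁ ≠ 0 → z₂ ≠ 0 →
      inner ℂ (LaguerreOscillator.coherent hα z₁) (LaguerreOscillator.coherent hα z₂) =
        ((starRingEnd ℂ) z₁ * z₂ / ((‖z₁‖ * ‖z₂‖ : ℝ) : ℂ)) ^ (-(α : ℂ) / 2) *
          LaguerreOscillator.besselI α
            (((√2 : ℝ) : ℂ) * ((starRingEnd ℂ) z₁ * z₂) ^ (1 / 2 : ℂ)) /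
          ((√(LaguerreOscillator.besselIReal α (√2 * ‖z₁‖) *
              LaguerreOscillator.besselIReal α (√2 * ‖z₂‖)) : ℝ) : ℂ)) ∧
    -- the values at `z = 0`, which the three formulas above have as limits
    (LaguerreOscillator.normSq α 0 = 1 ∧
      LaguerreOscillator.coherent hα 0 = LaguerreOscillator.fock hα 0 ∧
      ∀ z : ℂ,
        inner ℂ (LaguerreOscillator.coherent hα 0) (LaguerreOscillator.coherent hα z) =
          (((√(LaguerreOscillator.normSq α z))⁻¹ : ℝ) : ℂ)) ∧
    -- resolution of the identity `∫ |z⟩⟨z| dν(z) = 1`, in the weak sense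
    (∀ f g : LaguerreOscillator.FockSpace α,
      MeasureTheory.Integrable
        (fun z : ℂ => inner ℂ f (LaguerreOscillator.coherent hα z) *
          inner ℂ (LaguerreOscillator.coherent hα z) g)
        (LaguerreOscillator.coherentMeasure α) ∧
      ∫ z : ℂ, inner ℂ f (LaguerreOscillator.coherent hα z) *
          inner ℂ (LaguerreOscillator.coherent hα z) g
        ∂(LaguerreOscillator.coherentMeasure α) = inner ℂ f g) := by
  refine ⟨⟨LaguerreOscillator.isProbabilityMeasure_laguerreMeasure hα,
    LaguerreOscillator.orthonormal_fock hα, LaguerreOscillator.mul_laguerrePsi hα⟩,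
    fun z => ⟨LaguerreOscillator.summable_normSqTerm hα z,
      LaguerreOscillator.summable_coherentTerm hα z,
      LaguerreOscillator.norm_preCoherent_sq hα z, LaguerreOscillator.norm_coherent hα z⟩,
    fun z hz => LaguerreOscillator.normSq_eq_besselIReal hα hz,
    fun z hz => LaguerreOscillator.coherent_ae_eq hα hz,
    fun z₁ z₂ h₁ h₂ => LaguerreOscillator.inner_coherent hα h₁ h₂,
    ⟨LaguerreOscillator.normSq_zero α, LaguerreOscillator.coherent_zero hα,
      LaguerreOscillator.inner_coherent_zero hα⟩,
    LaguerreOscillator.resolution_of_identity hα⟩
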